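/- Let $p$ be a prime and $S$ a finite $p$-group. A fusion system $\mathcal F$ on $S$ is a category whose objects are the subgroups of $S$ and whose morphism sets satisfy $\operatorname{Hom}_S(P,Q)\subseteq \operatorname{Hom}_{\mathcal F}(P,Q)\subseteq\operatorname{Inj}(P,Q)$, where $\operatorname{Hom}_S(P,Q)$ is the set of maps $P\to Q$, $x\mapsto g^{-1}xg$, with $g\in S$ and $g^{-1}Pg\le Q$, and $\operatorname{Inj}(P,Q)$ is the set of injective group homomorphisms, such that every morphism factorizes as an $\mathcal F$-isomorphism onto its image followed by an inclusion. Write $\operatorname{Aut}_{\mathcal F}(P)=\operatorname{Hom}_{\mathcal F}(P,P)$ and $\operatorname{Out}_{\mathcal F}(P)=\operatorname{Aut}_{\mathcal F}(P)/\operatorname{Inn}(P)$, let $\operatorname{Aut}_S(P)$ be the group of automorphisms of $P$ induced by $N_S(P)$, and call the images of $P$ under morphisms in $\operatorname{Hom}_{\mathcal F}(P,S)$ the $\mathcal F$-conjugates of $P$. For an isomorphism $\alpha\colon P\to Q$ in $\mathcal F$, let $N_\alpha$ be the group of all $g\in N_S(P)$ for which the automorphism $y\mapsto\alpha(g^{-1}\alpha^{-1}(y)g)$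 of $Q$ lies in $\operatorname{Aut}_S(Q)$. The fusion system $\mathcal F$ is saturated if every $P\le S$ has an $\mathcal F$-conjugate $Q$ such that $\operatorname{Aut}_S(Q)\in\operatorname{Syl}_p(\operatorname{Aut}_{\mathcal F}(Q))$ and every $\mathcal F$-isomorphism $\alpha\colon R\to Q$ with $R\le S$ extends to a morphism $N_\alpha\to S$ in $\mathcal F$. A subgroup $P\le S$ is $\mathcal F$-essential if $P<S$, $C_S(Q)=Z(Q)$ and $|N_S(P)|\ge|N_S(Q)|$ for every $\mathcal F$-conjugate $Q$ of $P$, and $G=\operatorname{Out}_{\mathcal F}(P)$ has a strongly $p$-embedded subgroup, that is, a subgroup $H<G$ with $p\mid|H|$ and $p\nmid|H\cap gHg^{-1}|$ for all $g\in G\setminus H$. An $\mathcal F$-pearl is an $\mathcal F$-essential subgroup which is either of order $p^2$ or non-abelian of order $p^3$. Lemma (pearlprune). Let $\mathcal F$ be a saturated fusion system on the finite $p$-group $S$, and let $\mathcal C$ be a set of representatives of the $\mathcal F$-conjugacy classes of $\mathcal F$-essential subgroups (so $\mathcal C$ consists of $\mathcal F$-essential subgroups, and every $\mathcal F$-essential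 subgroup is $\mathcal F$-conjugate to exactly one member of $\mathcal C$). If $P\in\mathcal C$ is an $\mathcal F$-pearl, then the fusion system $$\mathcal G=\langle \operatorname{Aut}_{\mathcal F}(S),\ \operatorname{Aut}_{\mathcal F}(E)\mid E\in\mathcal C\setminus\{P\}\rangle,$$ that is, the smallest fusion system on $S$ containing all these automorphisms as morphisms, is saturated. -/

import Mathlib

/-- A fusion system on a group `S`: a category whose objects are the subgroups of `S` and whose
morphisms are injective group homomorphisms, containing all maps `x ↦ g⁻¹ x g` with `g ∈ S`
(in particular identities and inclusions), and such that every morphism factorizes as an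
isomorphism of the category onto a subgroup followed by an inclusion. -/
@[ext]
structure FusionSystem (S : Type*) [Group S] where
  Hom : (P Q : Subgroup S) → Set (P →* Q)
  injective' : ∀ {P Q : Subgroup S} (φ : P →* Q), φ ∈ Hom P Q → Function.Injective φ
  conj_mem' : ∀ {P Q : Subgroup S} (g : S) (φ : P →* Q),
    (∀ x : P, (φ x : S) = g⁻¹ * (x : S) * g) → φ ∈ Hom P Q
  comp_mem' : ∀ {P Q R : Subgroup S} (φ : P →* Q) (ψ : Q →* R),
    φ ∈ Hom P Q → ψ ∈ Hom Q R → ψ.comp φ ∈ Hom P R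
  factor' : ∀ {P Q : Subgroup S} (φ : P →* Q), φ ∈ Hom P Q →
    ∃ (R : Subgroup S) (hR : R ≤ Q) (e : P ≃* R),
      e.toMonoidHom ∈ Hom P R ∧ e.symm.toMonoidHom ∈ Hom R P ∧
        φ = (Subgroup.inclusion hR).comp e.toMonoidHom

/-- A subgroup `H` of a finite group `G` is strongly `p`-embedded if it is proper, has order
divisible by `p`, and `H ∩ gHg⁻¹` has order prime to `p` for all `g ∈ G \ H`. -/
def IsStronglyEmbedded (p : ℕ) {G : Type*} [Group G] (H : Subgroup G) : Prop :=
  H ≠ ⊤ ∧ p ∣ Nat.card H ∧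
    ∀ g : G, g ∉ H →
      ¬ p ∣ Nat.card (H ⊓ H.map (MulAut.conj g).toMonoidHom : Subgroup G)

/-- The group `Inn(G)` of inner automorphisms. -/
def innAut (G : Type*) [Group G] : Subgroup (MulAut G) :=
  (MulAut.conj : G →* MulAut G).range

instance innAut_normal (G : Type*) [Group G] : (innAut G).Normal := by
  refine ⟨?_⟩
  rintro _ ⟨x, rfl⟩ a
  refine ⟨a x, ?_⟩
  ext y
  simp [MulAut.conj_apply, MulAut.mul_apply]

namespace FusionSystem

variable {S : Type*} [Group S]

/-- `Aut_S(P)`: the automorphisms of `P` induced by conjugation by elements of `N_S(P)`. -/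
def autS (P : Subgroup S) : Subgroup (MulAut P) :=
  (Subgroup.normalizerMonoidHom P).range

/-- `P` is `S`-centric: `C_S(P) = Z(P)`. -/
def IsSCentric (P : Subgroup S) : Prop :=
  Subgroup.centralizer (P : Set S) = (Subgroup.center P).map P.subtype

/-- For an isomorphism `α : P → Q`, the subgroup `N_α` of those `g ∈ N_S(P)` such that the
automorphism of `Q` obtained by transporting conjugation by `g` along `α` lies in `Aut_S(Q)`. -/
def extControl {P Q : Subgroup S} (α : P ≃* Q) : Subgroup S :=
  (((autS Q).comap (MulAut.congr α).toMonoidHom).comap (Subgroup.normalizerMonoidHom P)).map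
    (Subgroup.normalizer (P : Set S)).subtype

theorem le_extControl {P Q : Subgroup S} (α : P ≃* Q) : P ≤ extControl α := by
  intro g hg
  refine ⟨⟨g, Subgroup.le_normalizer hg⟩, ?_, rfl⟩
  refine ⟨⟨α ⟨g, hg⟩, Subgroup.le_normalizer (α ⟨g, hg⟩).2⟩, ?_⟩
  ext y
  have h : Subgroup.normalizerMonoidHom P ⟨g, Subgroup.le_normalizer hg⟩ (α.symm y) =
      (⟨g, hg⟩ : P) * α.symm y * (⟨g, hg⟩ : P)⁻¹ := by
    ext
    simp
  have h' : (MulAut.congr α) (Subgroup.normalizerMonoidHom P ⟨g, Subgroup.le_normalizer hg⟩) y =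
      α (Subgroup.normalizerMonoidHom P ⟨g, Subgroup.le_normalizer hg⟩ (α.symm y)) := rfl
  change _ = (((MulAut.congr α)
    (Subgroup.normalizerMonoidHom P ⟨g, Subgroup.le_normalizer hg⟩) y : Q) : S)
  rw [h', h]
  simp

variable (F : FusionSystem S)

/-- `Aut_F(P) = Hom_F(P, P)`, as a group of automorphisms of `P`. -/
def autF (P : Subgroup S) : Subgroup (MulAut P) where
  carrier := {a | MulEquiv.toMonoidHom a ∈ F.Hom P P}
  mul_mem' {a b} ha hb := F.comp_mem' _ _ hb ha
  one_mem' := F.conj_mem' 1 _ (by intro x; simp)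
  inv_mem' {a} ha := by
    obtain ⟨R, hR, e, -, he, h⟩ := F.factor' _ ha
    have hval : ∀ x : P, ((a x : P) : S) = (e x : S) := fun x =>
      congrArg Subtype.val (DFunLike.congr_fun h x)
    have hRP : R = P := by
      refine le_antisymm hR fun x hx => ?_
      have := hval (a.symm ⟨x, hx⟩)
      rw [MulEquiv.apply_symm_apply] at this
      change x = _ at this
      rw [this]
      exact (e _).2
    subst hRP
    have hae : a = e := MulEquiv.ext fun x => Subtype.ext (hval x)
    subst hae
    exact he

/-- `P` and `Q` are `F`-conjugate, that is, `Q` is the image of `P` under a morphism of `F`. -/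
def IsConj (P Q : Subgroup S) : Prop :=
  ∃ φ ∈ F.Hom P ⊤, Q = φ.range.map (⊤ : Subgroup S).subtype

def IsFullyNormalized (P : Subgroup S) : Prop :=
  ∀ Q, F.IsConj P Q →
    Nat.card (Subgroup.normalizer (Q : Set S)) ≤ Nat.card (Subgroup.normalizer (P : Set S))

/-- `Aut_S(P)` is a Sylow `p`-subgroup of `Aut_F(P)`. -/
def IsFullyAutomized (p : ℕ) (P : Subgroup S) : Prop :=
  ∃ T : Sylow p (F.autF P), (T : Subgroup (F.autF P)) = (autS P).subgroupOf (F.autF P)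

/-- Every isomorphism `α : P → Q` in `F` extends to a morphism `N_α → S` in `F`. -/
def IsReceptive (Q : Subgroup S) : Prop :=
  ∀ (P : Subgroup S) (α : P ≃* Q), α.toMonoidHom ∈ F.Hom P Q →
    ∃ β ∈ F.Hom (extControl α) ⊤,
      ∀ x : P, ((β (Subgroup.inclusion (le_extControl α) x) : (⊤ : Subgroup S)) : S) = (α x : S)

/-- `F` is saturated (with respect to the prime `p`): every subgroup of `S` is `F`-conjugate to a
fully automized and receptive subgroup. -/
def IsSaturated (p : ℕ) : Prop :=
  ∀ P : Subgroup S, ∃ Q, F.IsConj P Q ∧ F.IsFullyAutomized p Q ∧ F.IsReceptive Q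

def IsCentric (P : Subgroup S) : Prop :=
  ∀ Q, F.IsConj P Q → IsSCentric Q

/-- `Out_F(P) = Aut_F(P) / Inn(P)`. -/
abbrev outF (P : Subgroup S) : Type _ :=
  F.autF P ⧸ (innAut P).subgroupOf (F.autF P)

def IsEssential (p : ℕ) (P : Subgroup S) : Prop :=
  P < ⊤ ∧ F.IsCentric P ∧ F.IsFullyNormalized P ∧
    ∃ H : Subgroup (F.outF P), IsStronglyEmbedded p H

/-- An essential subgroup that has order `p²` or is non-abelian of order `p³`. -/
def IsPearl (p : ℕ) (P : Subgroup S) : Prop :=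
  F.IsEssential p P ∧
    (Nat.card P = p ^ 2 ∨ (Nat.card P = p ^ 3 ∧ ¬ ∀ x y : P, x * y = y * x))

/-- `C` consists of essential subgroups, exactly one from each `F`-conjugacy class
containing an essential subgroup. -/
def IsEssentialReps (p : ℕ) (C : Set (Subgroup S)) : Prop :=
  (∀ E ∈ C, F.IsEssential p E) ∧ ∀ E, F.IsEssential p E → ∃! R, R ∈ C ∧ F.IsConj E R

/-- All members of a set `X` of homomorphisms between subgroups of `S` are morphisms of `F`. -/
def Contains (X : Set (Σ P : Subgroup S, Σ Q : Subgroup S, P →* Q)) : Prop :=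
  ∀ x ∈ X, x.2.2 ∈ F.Hom x.1 x.2.1

/-- The fusion system `⟨X⟩` generated by a set `X` of monomorphisms between subgroups of `S`: the
intersection of all fusion systems on `S` containing `X`. -/
def generate (X : Set (Σ P : Subgroup S, Σ Q : Subgroup S, P →* Q)) : FusionSystem S where
  Hom P Q := {φ | Function.Injective φ ∧ ∀ G : FusionSystem S, G.Contains X → φ ∈ G.Hom P Q}
  injective' _ h := h.1
  conj_mem' {P Q} g φ h := by
    refine ⟨fun x y hxy => ?_, fun G _ => G.conj_mem' g φ h⟩
    have := h x
    rw [hxy, h y] at this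
    exact Subtype.ext (by simpa using this.symm)
  comp_mem' φ ψ hφ hψ :=
    ⟨hψ.1.comp hφ.1, fun G hG => G.comp_mem' φ ψ (hφ.2 G hG) (hψ.2 G hG)⟩
  factor' {P Q} φ hφ := by
    let R : Subgroup S := (Q.subtype.comp φ).range
    have hR : R ≤ Q := by
      rintro _ ⟨x, rfl⟩
      exact (φ x).2
    let e : P ≃* R := MonoidHom.ofInjective (f := Q.subtype.comp φ)
      (Q.subtype_injective.comp hφ.1)
    have key : ∀ G : FusionSystem S, G.Contains X →
        e.toMonoidHom ∈ G.Hom P R ∧ e.symm.toMonoidHom ∈ G.Hom R P := by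
      intro G hG
      obtain ⟨R', hR', e', h1, h2, h3⟩ := G.factor' φ (hφ.2 G hG)
      have hval : ∀ x : P, (e' x : S) = (e x : S) := fun x =>
        (congrArg Subtype.val (DFunLike.congr_fun h3 x)).symm
      have hRR : R' = R := by
        ext y
        constructor
        · intro hy
          have := hval (e'.symm ⟨y, hy⟩)
          rw [MulEquiv.apply_symm_apply] at this
          change y = _ at this
          rw [this]
          exact (e _).2
        · intro hy
          have := hval (e.symm ⟨y, hy⟩)
          rw [MulEquiv.apply_symm_apply] at this
          change _ = y at this
          rw [← this]
          exact (e' _).2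
      subst hRR
      have hee : e' = e := MulEquiv.ext fun x => Subtype.ext (hval x)
      rw [← hee]
      exact ⟨h1, h2⟩
    exact ⟨R, hR, e, ⟨e.injective, fun G hG => (key G hG).1⟩,
      ⟨e.symm.injective, fun G hG => (key G hG).2⟩, rfl⟩

/-- The set of all elements of the groups `Aut_F(E)` with `E ∈ D`. -/
def automizers (D : Set (Subgroup S)) : Set (Σ P : Subgroup S, Σ Q : Subgroup S, P →* Q) :=
  {x | ∃ E ∈ D, ∃ a ∈ F.autF E, x = ⟨E, E, MulEquiv.toMonoidHom a⟩}

end FusionSystem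

/-!
By Alperin's theorem every morphism of `F` is composed of restrictions of automorphisms of `S` and
of essential subgroups. Leaving out those of `P` only affects subgroups that are conjugate into
`P`, so morphisms on all other subgroups survive in the pruned system `G`. The `F`-class of `Q`
may split into several `G`-classes, each of which needs a fully automized receptive member. If
neither `N_S(A)` nor an extension domain strictly larger than `A` is `F`-conjugate into `P`, then
the extensions that saturation of `F` provides from `A` survive in `G`, and the `G`-class of `A`
has such a member as in `F`; it is enough that `A` can be moved along its normalizer to a subgroup
with this property. In the remaining `G`-classes, which consist of subgroups of order at most
`p ^ 2`, each left-over automorphism defined on a member `A` is also defined on `N_S(A)`, so all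
morphisms of `G` extend to normalizers.

If `P` has order `p ^ 3`, the strongly embedded subgroup of `Out_F(P)` ensures that every subgroup
of order `p ^ 2` of `P` is `F`-conjugate to one normalized by `N_S(P)`, which has order at least
`p ^ 4`. Hence a subgroup of order `p ^ 2` whose normalizer is conjugate to `P` is not essential.
-/

namespace FusionSystem

variable {S : Type*} [Group S]

/-- The image of a subgroup `A` under a map `f`. Taking the closure makes this a subgroup for every
`f`; it is the plain image as soon as `f` is multiplicative on `A`. -/
def img (f : S → S) (A : Subgroup S) : Subgroup S := Subgroup.closure (f '' A)

/-- The restriction of `f : S → S` to `A` is a morphism of `F`. Encoding morphisms by maps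
defined on all of `S` makes restrictions, composites and images independent of dependent types. -/
def IsMor (F : FusionSystem S) (f : S → S) (A : Subgroup S) : Prop :=
  ∃ φ ∈ F.Hom A ⊤, ∀ x : A, ((φ x : (⊤ : Subgroup S)) : S) = f x

variable {F : FusionSystem S} {f g : S → S} {A B C : Subgroup S}

theorem img_mono (f : S → S) (h : A ≤ B) : img f A ≤ img f B :=
  Subgroup.closure_mono (Set.image_mono h)

theorem img_congr (h : ∀ x ∈ A, f x = g x) : img f A = img g A :=
  congrArg Subgroup.closure (Set.image_congr h)

theorem apply_mem_img (f : S → S) {x : S} (hx : x ∈ A) : f x ∈ img f A :=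
  Subgroup.subset_closure ⟨x, hx, rfl⟩

theorem img_le_iff : img f A ≤ B ↔ ∀ x ∈ A, f x ∈ B :=
  (Subgroup.closure_le B).trans Set.image_subset_iff

theorem img_id (A : Subgroup S) : img id A = A := by
  simp only [img, Set.image_id, Subgroup.closure_eq]

theorem img_eq_range {φ : A →* B} (h : ∀ x : A, (φ x : S) = f x) :
    img f A = (B.subtype.comp φ).range := by
  have himage : f '' A = ((B.subtype.comp φ).range : Set S) := by
    ext y
    simp [h]
  rw [img, himage, Subgroup.closure_eq]

theorem img_eq_map {φ : A →* B} (h : ∀ x : A, (φ x : S) = f x) (hC : C ≤ A) :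
    img f C = (C.subgroupOf A).map (B.subtype.comp φ) := by
  rw [img_eq_range (φ := φ.comp (Subgroup.inclusion hC)) fun x => h (Subgroup.inclusion hC x),
    ← MonoidHom.comp_assoc, MonoidHom.range_comp, Subgroup.inclusion_range]

theorem img_eq_of_mulEquiv (e : A ≃* B) (h : ∀ x : A, (e x : S) = f x) : img f A = B := by
  rw [img_eq_range (φ := e.toMonoidHom) h, MonoidHom.range_comp,
    MonoidHom.range_eq_top.2 e.surjective, ← MonoidHom.range_eq_map, Subgroup.range_subtype]

theorem exists_forall_coe_eq (φ : A → B) : ∃ f : S → S, ∀ x : A, (φ x : S) = f x := by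
  classical
  refine ⟨fun s => if h : s ∈ A then φ ⟨s, h⟩ else 1, fun x => ?_⟩
  simp only [SetLike.coe_mem, Subtype.coe_eta, dite_true]

theorem inclusion_mem_hom (F : FusionSystem S) (h : A ≤ B) : Subgroup.inclusion h ∈ F.Hom A B :=
  F.conj_mem' 1 _ (by simp)

theorem isMor_of_mem_hom {φ : A →* B} (hφ : φ ∈ F.Hom A B) (h : ∀ x : A, (φ x : S) = f x) :
    F.IsMor f A :=
  ⟨(Subgroup.inclusion le_top).comp φ, F.comp_mem' _ _ hφ (F.inclusion_mem_hom le_top), h⟩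

theorem isMor_conj (F : FusionSystem S) (s : S) (A : Subgroup S) :
    F.IsMor (fun x => s * x * s⁻¹) A :=
  isMor_of_mem_hom (B := ⊤)
    (φ := ((MulAut.conj s).toMonoidHom.comp A.subtype).codRestrict ⊤ fun _ => trivial)
    (F.conj_mem' s⁻¹ _ (by simp)) (by simp)

theorem img_conj (s : S) (A : Subgroup S) :
    img (fun x => s * x * s⁻¹) A = A.map (MulAut.conj s) := by
  rw [← Subgroup.closure_eq (A.map _), Subgroup.coe_map]
  rfl

theorem isMor_id (F : FusionSystem S) (A : Subgroup S) : F.IsMor id A :=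
  isMor_of_mem_hom (F.inclusion_mem_hom le_rfl) fun _ => rfl

theorem IsMor.exists_mulEquiv (hf : F.IsMor f A) :
    ∃ e : A ≃* img f A, e.toMonoidHom ∈ F.Hom A (img f A) ∧
      e.symm.toMonoidHom ∈ F.Hom (img f A) A ∧ ∀ x : A, (e x : S) = f x := by
  obtain ⟨φ, hφ, hφf⟩ := hf
  obtain ⟨R, hR, e, he, he', rfl⟩ := F.factor' φ hφ
  obtain rfl := img_eq_of_mulEquiv e hφf
  exact ⟨e, he, he', hφf⟩

theorem IsMor.mem_hom (hf : F.IsMor f A) {φ : A →* B} (h : ∀ x : A, (φ x : S) = f x) :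
    φ ∈ F.Hom A B := by
  obtain ⟨e, he, -, hef⟩ := hf.exists_mulEquiv
  have hB : img f A ≤ B := img_le_iff.2 fun x hx => h ⟨x, hx⟩ ▸ (φ ⟨x, hx⟩).2
  have hφ : φ = (Subgroup.inclusion hB).comp e.toMonoidHom :=
    MonoidHom.ext fun x => Subtype.ext ((h x).trans (hef x).symm)
  exact hφ ▸ F.comp_mem' _ _ he (F.inclusion_mem_hom hB)

theorem mem_autF_iff {a : MulAut A} (h : ∀ x : A, (a x : S) = f x) : a ∈ F.autF A ↔ F.IsMor f A :=
  ⟨fun ha => isMor_of_mem_hom (φ := MulEquiv.toMonoidHom a) ha h, fun hf => hf.mem_hom h⟩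

namespace IsMor

theorem map_mul (hf : F.IsMor f A) {x y : S} (hx : x ∈ A) (hy : y ∈ A) :
    f (x * y) = f x * f y := by
  obtain ⟨e, -, -, h⟩ := hf.exists_mulEquiv
  simpa only [Subgroup.coe_mul, h] using
    congrArg Subtype.val (_root_.map_mul e ⟨x, hx⟩ ⟨y, hy⟩)

theorem map_one (hf : F.IsMor f A) : f 1 = 1 := by
  simpa only [mul_one, left_eq_mul] using hf.map_mul A.one_mem A.one_mem

theorem map_inv (hf : F.IsMor f A) {x : S} (hx : x ∈ A) : f x⁻¹ = (f x)⁻¹ := by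
  refine eq_inv_of_mul_eq_one_left ?_
  rw [← hf.map_mul (A.inv_mem hx) hx, inv_mul_cancel, hf.map_one]

theorem map_conj (hf : F.IsMor f A) {x y : S} (hx : x ∈ A) (hy : y ∈ A) :
    f (x * y * x⁻¹) = f x * f y * (f x)⁻¹ := by
  rw [hf.map_mul (A.mul_mem hx hy) (A.inv_mem hx), hf.map_mul hx hy, hf.map_inv hx]

theorem injOn (hf : F.IsMor f A) : Set.InjOn f A := by
  obtain ⟨e, -, -, h⟩ := hf.exists_mulEquiv
  intro _ hx _ hy hxy
  refine congrArg Subtype.val (e.injective (a₁ := ⟨_, hx⟩) (a₂ := ⟨_, hy⟩) (Subtype.ext ?_))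
  rw [h, h]
  exact hxy

theorem mem_img (hf : F.IsMor f A) {y : S} : y ∈ img f A ↔ ∃ x ∈ A, f x = y := by
  obtain ⟨φ, -, h⟩ := hf
  rw [img_eq_range h]
  simp [h]

theorem coe_img (hf : F.IsMor f A) : (img f A : Set S) = f '' A :=
  Set.ext fun _ => hf.mem_img

theorem congr (hf : F.IsMor f A) (h : ∀ x ∈ A, f x = g x) : F.IsMor g A := by
  obtain ⟨φ, hφ, hφf⟩ := hf
  exact ⟨φ, hφ, fun x => (hφf x).trans (h x x.2)⟩

theorem restrict (hf : F.IsMor f A) (h : B ≤ A) : F.IsMor f B := by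
  obtain ⟨φ, hφ, hφf⟩ := hf
  exact ⟨φ.comp (Subgroup.inclusion h), F.comp_mem' _ _ (F.inclusion_mem_hom h) hφ,
    fun x => hφf (Subgroup.inclusion h x)⟩

theorem apply_mem_img_iff (hf : F.IsMor f A) (h : B ≤ A) {x : S} (hx : x ∈ A) :
    f x ∈ img f B ↔ x ∈ B := by
  refine ⟨fun hfx => ?_, apply_mem_img f⟩
  obtain ⟨y, hy, hyx⟩ := (hf.restrict h).mem_img.1 hfx
  rwa [← hf.injOn (h hy) hx hyx]

theorem img_le_img_iff (hf : F.IsMor f A) (hB : B ≤ A) (hC : C ≤ A) :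
    img f B ≤ img f C ↔ B ≤ C :=
  ⟨fun h _ hx => (hf.apply_mem_img_iff hC (hB hx)).1 (h (apply_mem_img f hx)), img_mono f⟩

theorem card_img (hf : F.IsMor f A) : Nat.card (img f A) = Nat.card A := by
  obtain ⟨e, -⟩ := hf.exists_mulEquiv
  exact (Nat.card_congr e.toEquiv).symm

theorem img_inj (hf : F.IsMor f A) (hB : B ≤ A) (hC : C ≤ A) : img f B = img f C ↔ B = C := by
  simp only [le_antisymm_iff, hf.img_le_img_iff hB hC, hf.img_le_img_iff hC hB]

theorem img_sup (hf : F.IsMor f A) (hB : B ≤ A) (hC : C ≤ A) :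
    img f (B ⊔ C) = img f B ⊔ img f C := by
  obtain ⟨φ, -, h⟩ := hf
  rw [img_eq_map h hB, img_eq_map h hC, img_eq_map h (sup_le hB hC),
    Subgroup.subgroupOf_sup hB hC, Subgroup.map_sup]

theorem exists_mem_autF (hf : F.IsMor f A) (hfA : img f A = A) :
    ∃ a ∈ F.autF A, ∀ x : A, (a x : S) = f x := by
  obtain ⟨e, -, -, hef⟩ := hf.exists_mulEquiv
  let a : MulAut A := e.trans (MulEquiv.subgroupCongr hfA)
  have ha : ∀ x : A, (a x : S) = f x := hef
  exact ⟨a, (mem_autF_iff ha).2 hf, ha⟩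

theorem img_comp (hf : F.IsMor f A) (g : S → S) : img (g ∘ f) A = img g (img f A) := by
  rw [img, img, Set.image_comp, ← hf.coe_img]

theorem comp (hg : F.IsMor g B) (hf : F.IsMor f A) (h : img f A ≤ B) : F.IsMor (g ∘ f) A := by
  obtain ⟨e, he, -, hef⟩ := hf.exists_mulEquiv
  obtain ⟨ψ, hψ, hψg⟩ := hg.restrict h
  exact ⟨ψ.comp e.toMonoidHom, F.comp_mem' _ _ he hψ, fun x => by simp [hψg, hef]⟩

theorem exists_inverse (hf : F.IsMor f A) :
    ∃ g, F.IsMor g (img f A) ∧ (∀ x ∈ A, g (f x) = x) ∧ img g (img f A) = A := by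
  obtain ⟨e, -, he, hef⟩ := hf.exists_mulEquiv
  obtain ⟨g, hg⟩ := exists_forall_coe_eq e.symm
  refine ⟨g, isMor_of_mem_hom he hg, fun x hx => ?_, img_eq_of_mulEquiv e.symm hg⟩
  rw [← hef ⟨x, hx⟩, ← hg, MulEquiv.symm_apply_apply]

theorem img_map_conj (hf : F.IsMor f A) (hB : B ≤ A) {x : S} (hx : x ∈ A) :
    img f (B.map (MulAut.conj x)) = (img f B).map (MulAut.conj (f x)) := by
  rw [← img_conj, ← img_conj, ← (F.isMor_conj x B).img_comp, ← (hf.restrict hB).img_comp]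
  exact img_congr fun b hb => hf.map_conj hx (hB hb)

theorem apply_mem_normalizer_iff (hf : F.IsMor f A) (hB : B ≤ A) {x : S} (hx : x ∈ A) :
    f x ∈ Subgroup.normalizer (img f B : Set S) ↔ x ∈ Subgroup.normalizer (B : Set S) := by
  have hconj : B.map (MulAut.conj x) ≤ A := by
    rintro _ ⟨b, hb, rfl⟩
    exact A.mul_mem (A.mul_mem hx (hB hb)) (A.inv_mem hx)
  rw [Subgroup.mem_normalizer_iff_map_conj_eq, Subgroup.mem_normalizer_iff_map_conj_eq,
    ← hf.img_map_conj hB hx, hf.img_inj hconj hB]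

theorem apply_mem_centralizer (hf : F.IsMor f A) (hB : B ≤ A) {x : S} (hx : x ∈ A)
    (hxc : x ∈ Subgroup.centralizer (B : Set S)) :
    f x ∈ Subgroup.centralizer (img f B : Set S) := by
  rw [Subgroup.mem_centralizer_iff] at hxc ⊢
  intro y hy
  obtain ⟨b, hb, rfl⟩ := (hf.restrict hB).mem_img.1 hy
  rw [← hf.map_mul hx (hB hb), ← hf.map_mul (hB hb) hx, hxc b hb]

end IsMor

theorem isConj_iff {P Q : Subgroup S} : F.IsConj P Q ↔ ∃ f, F.IsMor f P ∧ img f P = Q := by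
  constructor
  · rintro ⟨φ, hφ, rfl⟩
    obtain ⟨f, hf⟩ := exists_forall_coe_eq φ
    exact ⟨f, isMor_of_mem_hom hφ hf, (img_eq_range hf).trans (MonoidHom.range_comp _ φ)⟩
  · rintro ⟨f, ⟨φ, hφ, hf⟩, rfl⟩
    exact ⟨φ, hφ, (img_eq_range hf).trans (MonoidHom.range_comp _ φ)⟩

theorem IsMor.isConj (hf : F.IsMor f A) : F.IsConj A (img f A) := isConj_iff.2 ⟨f, hf, rfl⟩

namespace IsConj

theorem refl (F : FusionSystem S) (A : Subgroup S) : F.IsConj A A :=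
  isConj_iff.2 ⟨id, F.isMor_id A, img_id A⟩

theorem symm (h : F.IsConj A B) : F.IsConj B A := by
  obtain ⟨f, hf, rfl⟩ := isConj_iff.1 h
  obtain ⟨g, hg, -, hgA⟩ := hf.exists_inverse
  exact isConj_iff.2 ⟨g, hg, hgA⟩

theorem trans (h : F.IsConj A B) (h' : F.IsConj B C) : F.IsConj A C := by
  obtain ⟨f, hf, rfl⟩ := isConj_iff.1 h
  obtain ⟨g, hg, rfl⟩ := isConj_iff.1 h'
  exact isConj_iff.2 ⟨g ∘ f, hg.comp hf le_rfl, hf.img_comp g⟩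

theorem card_eq (h : F.IsConj A B) : Nat.card B = Nat.card A := by
  obtain ⟨f, hf, rfl⟩ := isConj_iff.1 h
  exact hf.card_img

end IsConj

end FusionSystem

open scoped Pointwise in
theorem exists_smul_le_sylow {p : ℕ} [Fact p.Prime] {G : Type*} [Group G] [Finite (Sylow p G)]
    (T : Sylow p G) {U : Subgroup G} (hU : IsPGroup p U) : ∃ g : G, MulAut.conj g • U ≤ T := by
  obtain ⟨T', hT'⟩ := hU.exists_le_sylow
  obtain ⟨g, rfl⟩ := MulAction.exists_smul_eq G T' T
  exact ⟨g, Subgroup.pointwise_smul_le_pointwise_smul_iff.2 hT'⟩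

namespace FusionSystem

variable {S : Type*} [Group S] {F : FusionSystem S} {p : ℕ}

theorem mem_autS_iff {A : Subgroup S} {a : MulAut A} :
    a ∈ autS A ↔ ∃ h ∈ Subgroup.normalizer (A : Set S), ∀ x : A, (a x : S) = h * x * h⁻¹ := by
  constructor
  · rintro ⟨h, rfl⟩
    exact ⟨h, h.2, fun x => Subgroup.normalizerMonoidHom_apply_apply_coe A h x⟩
  · rintro ⟨h, hh, hx⟩
    refine ⟨⟨h, hh⟩, MulEquiv.ext fun x => Subtype.ext ?_⟩
    exact (Subgroup.normalizerMonoidHom_apply_apply_coe A ⟨h, hh⟩ x).trans (hx x).symm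

theorem autS_le_autF (F : FusionSystem S) (A : Subgroup S) : autS A ≤ F.autF A := by
  intro a ha
  obtain ⟨h, -, hx⟩ := mem_autS_iff.1 ha
  exact (mem_autF_iff hx).2 (F.isMor_conj h A)

theorem isPGroup_autS (hS : IsPGroup p S) (A : Subgroup S) : IsPGroup p (autS A) :=
  (hS.to_subgroup (Subgroup.normalizer (A : Set S))).of_surjective
    (Subgroup.normalizerMonoidHom A).rangeRestrict (MonoidHom.rangeRestrict_surjective _)

theorem isFullyAutomized_iff (hS : IsPGroup p S) {R : Subgroup S} :
    F.IsFullyAutomized p R ↔ ∀ U : Subgroup (MulAut R), IsPGroup p U → U ≤ F.autF R →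
      autS R ≤ U → U = autS R := by
  constructor
  · rintro ⟨T, hT⟩ U hU hUF hRU
    have hUT : U.subgroupOf (F.autF R) = T :=
      T.is_maximal' (hU.comap_of_injective _ (Subgroup.subtype_injective _))
        (hT ▸ Subgroup.comap_mono hRU)
    rwa [hT, Subgroup.subgroupOf_inj, inf_eq_left.2 hUF, inf_eq_left.2 (F.autS_le_autF R)] at hUT
  · intro h
    refine ⟨⟨(autS R).subgroupOf (F.autF R),
      (isPGroup_autS hS R).comap_of_injective _ (Subgroup.subtype_injective _), ?_⟩, rfl⟩
    intro T hT hle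
    have hmap := h (T.map (F.autF R).subtype) (hT.map _) (Subgroup.map_subtype_le T) ?_
    · rw [← hmap, ← Subgroup.comap_subtype, Subgroup.comap_map_eq_self_of_injective
        (Subgroup.subtype_injective _)]
    · rw [← inf_eq_left.2 (F.autS_le_autF R), ← Subgroup.subgroupOf_map_subtype]
      exact Subgroup.map_mono hle

theorem isFullyAutomized_of_card_le [Finite S] (hS : IsPGroup p S) {R : Subgroup S}
    (h : ∀ U : Subgroup (MulAut R), IsPGroup p U → Nat.card U ≤ Nat.card (autS R)) :
    F.IsFullyAutomized p R :=
  (isFullyAutomized_iff hS).2 fun U hU _ hle => (Subgroup.eq_of_le_of_card_ge hle (h U hU)).symm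

theorem IsFullyAutomized.mono {G : FusionSystem S} (hS : IsPGroup p S) {R : Subgroup S}
    (h : F.IsFullyAutomized p R) (hGF : G.autF R ≤ F.autF R) : G.IsFullyAutomized p R :=
  (isFullyAutomized_iff hS).2 fun U hU hUG =>
    (isFullyAutomized_iff hS).1 h U hU (hUG.trans hGF)

/-- The set `N_f` of those `g ∈ N_S(A)` for which the automorphism of `A` induced by `g` is
transported by `f` to one induced by an element of `S`; the counterpart of `extControl` for
morphisms given by maps on `S`. -/
def extSet (f : S → S) (A : Subgroup S) : Set S :=
  {g | g ∈ Subgroup.normalizer (A : Set S) ∧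
    ∃ h ∈ Subgroup.normalizer (img f A : Set S), ∀ x ∈ A, f (g * x * g⁻¹) = h * f x * h⁻¹}

theorem extSet_subset_normalizer (f : S → S) (A : Subgroup S) :
    extSet f A ⊆ Subgroup.normalizer (A : Set S) := fun _ => And.left

theorem coe_extControl {A B : Subgroup S} (α : A ≃* B) {f : S → S}
    (h : ∀ x : A, (α x : S) = f x) : (extControl α : Set S) = extSet f A := by
  obtain rfl := img_eq_of_mulEquiv α h
  have hconj : ∀ (g : Subgroup.normalizer (A : Set S)) (x : A),
      (MulAut.congr α (Subgroup.normalizerMonoidHom A g) (α x) : S) = f (g * x * g⁻¹) := by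
    intro g x
    rw [MulAut.congr_apply]
    simp [h]
  ext g
  simp only [extControl, Subgroup.coe_map, Subgroup.coe_comap, extSet]
  constructor
  · rintro ⟨g, hg, rfl⟩
    obtain ⟨k, hk, hkx⟩ := mem_autS_iff.1 hg
    refine ⟨g.2, k, hk, fun x hx => ?_⟩
    rw [← h ⟨x, hx⟩, ← hkx]
    exact (hconj g ⟨x, hx⟩).symm
  · rintro ⟨hg, k, hk, hkx⟩
    refine ⟨⟨g, hg⟩, mem_autS_iff.2 ⟨k, hk, fun y => ?_⟩, rfl⟩
    obtain ⟨x, rfl⟩ := α.surjective y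
    rw [h, ← hkx x x.2]
    exact hconj ⟨g, hg⟩ x

theorem isReceptive_iff {Q : Subgroup S} : F.IsReceptive Q ↔
    ∀ (A : Subgroup S) (f : S → S), F.IsMor f A → img f A = Q →
      ∃ N : Subgroup S, (N : Set S) = extSet f A ∧ ∃ k, F.IsMor k N ∧ ∀ x ∈ A, k x = f x := by
  constructor
  · rintro hQ A f hf rfl
    obtain ⟨e, he, -, hef⟩ := hf.exists_mulEquiv
    obtain ⟨β, hβ, hβx⟩ := hQ A e he
    obtain ⟨k, hk⟩ := exists_forall_coe_eq β
    refine ⟨extControl e, coe_extControl e hef, k, isMor_of_mem_hom hβ hk, fun x hx => ?_⟩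
    rw [← hef ⟨x, hx⟩, ← hβx ⟨x, hx⟩, hk, Subgroup.coe_inclusion]
  · intro hQ A e he
    obtain ⟨f, hef⟩ := exists_forall_coe_eq e
    obtain ⟨N, hN, k, hk, hkx⟩ :=
      hQ A f (isMor_of_mem_hom he hef) (img_eq_of_mulEquiv e hef)
    obtain rfl : N = extControl e := SetLike.coe_injective (hN.trans (coe_extControl e hef).symm)
    obtain ⟨β, hβ, hβx⟩ := hk
    exact ⟨β, hβ, fun x => (hβx _).trans ((hkx x x.2).trans (hef x).symm)⟩

theorem IsMor.subset_extSet {f : S → S} {A : Subgroup S} (hf : F.IsMor f A) :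
    (A : Set S) ⊆ extSet f A := fun g hg =>
  ⟨Subgroup.le_normalizer hg, f g, Subgroup.le_normalizer (apply_mem_img f hg),
    fun _ hx => hf.map_conj hg hx⟩

theorem centralizer_subset_extSet (f : S → S) (A : Subgroup S) :
    (Subgroup.centralizer (A : Set S) : Set S) ⊆ extSet f A := fun g hg => by
  have hconj : ∀ x ∈ A, g * x * g⁻¹ = x := fun x hx => by
    rw [← Subgroup.mem_centralizer_iff.1 hg x hx, mul_inv_cancel_right]
  exact ⟨Subgroup.centralizer_le_normalizer _ hg, 1, one_mem _, fun x hx => by simp [hconj x hx]⟩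

theorem congr_mem_autF {A B : Subgroup S} {e : A ≃* B} (he : e.toMonoidHom ∈ F.Hom A B)
    (he' : e.symm.toMonoidHom ∈ F.Hom B A) {a : MulAut A} (ha : a ∈ F.autF A) :
    MulAut.congr e a ∈ F.autF B :=
  F.comp_mem' _ _ (F.comp_mem' _ _ he' ha) he

open scoped Pointwise in
theorem IsFullyAutomized.exists_normalizer_le_extControl [Finite S] [Fact p.Prime]
    (hS : IsPGroup p S) {Q R : Subgroup S} (hR : F.IsFullyAutomized p R) {e : Q ≃* R}
    (he : e.toMonoidHom ∈ F.Hom Q R) (he' : e.symm.toMonoidHom ∈ F.Hom R Q) :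
    ∃ c ∈ F.autF R, Subgroup.normalizer (Q : Set S) ≤ extControl (e.trans c) := by
  obtain ⟨T, hT⟩ := hR
  let U : Subgroup (MulAut R) := (autS Q).map (MulAut.congr e).toMonoidHom
  obtain ⟨c, hc⟩ := exists_smul_le_sylow T (U := U.subgroupOf (F.autF R))
    (((isPGroup_autS hS Q).map _).comap_of_injective _ (Subgroup.subtype_injective _))
  refine ⟨c, c.2, fun g hg => ⟨⟨g, hg⟩, ?_, rfl⟩⟩
  have ha : Subgroup.normalizerMonoidHom Q ⟨g, hg⟩ ∈ autS Q := ⟨_, rfl⟩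
  have hmem := hc (Subgroup.smul_mem_pointwise_smul
    (⟨_, congr_mem_autF he he' (F.autS_le_autF Q ha)⟩ : F.autF R) (MulAut.conj c) _ ⟨_, ha, rfl⟩)
  rw [hT] at hmem
  exact hmem

theorem exists_isMor_normalizer [Finite S] [Fact p.Prime] (hS : IsPGroup p S)
    {Q R : Subgroup S} (ha : F.IsFullyAutomized p R) (hr : F.IsReceptive R) (hQR : F.IsConj Q R) :
    ∃ k, F.IsMor k (Subgroup.normalizer (Q : Set S)) ∧ img k Q = R := by
  obtain ⟨f, hf, rfl⟩ := isConj_iff.1 hQR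
  obtain ⟨e, he, he', -⟩ := hf.exists_mulEquiv
  obtain ⟨c, hc, hN⟩ := ha.exists_normalizer_le_extControl hS he he'
  obtain ⟨β, hβ, hβx⟩ := hr Q (e.trans c) (F.comp_mem' _ _ he hc)
  obtain ⟨k, hk⟩ := exists_forall_coe_eq β
  refine ⟨k, (isMor_of_mem_hom hβ hk).restrict hN, img_eq_of_mulEquiv (e.trans c) fun x => ?_⟩
  rw [← hβx x, hk, Subgroup.coe_inclusion]

variable {G : FusionSystem S} {D : Set (Subgroup S)} {f : S → S} {A B E : Subgroup S}

/-- Fusion systems on `S` are ordered by inclusion of their morphism sets. -/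
instance : LE (FusionSystem S) := ⟨fun F G => ∀ A B, F.Hom A B ⊆ G.Hom A B⟩

theorem IsMor.mono (h : F ≤ G) (hf : F.IsMor f A) : G.IsMor f A := by
  obtain ⟨φ, hφ, hφf⟩ := hf
  exact ⟨φ, h _ _ hφ, hφf⟩

theorem IsConj.mono (h : F ≤ G) (hAB : F.IsConj A B) : G.IsConj A B := by
  obtain ⟨φ, hφ, hB⟩ := hAB
  exact ⟨φ, h _ _ hφ, hB⟩

theorem autF_mono (h : F ≤ G) (A : Subgroup S) : F.autF A ≤ G.autF A := fun _ ha => h _ _ ha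

theorem generate_le {X : Set (Σ P : Subgroup S, Σ Q : Subgroup S, P →* Q)} (h : F.Contains X) :
    generate X ≤ F := fun _ _ _ hφ => hφ.2 F h

/-- The fusion system `⟨Aut_F(E) ∣ E ∈ D⟩`. -/
abbrev generateAut (F : FusionSystem S) (D : Set (Subgroup S)) : FusionSystem S :=
  generate (F.automizers D)

theorem generateAut_le (F : FusionSystem S) (D : Set (Subgroup S)) : F.generateAut D ≤ F :=
  generate_le <| by
    rintro _ ⟨E, -, a, ha, rfl⟩
    exact ha

theorem autF_le_autF_generateAut (F : FusionSystem S) (hE : E ∈ D) :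
    F.autF E ≤ (F.generateAut D).autF E := fun a ha =>
  ⟨a.injective, fun _ hG => hG _ ⟨E, hE, a, ha, rfl⟩⟩

theorem IsMor.generateAut (ha : F.IsMor f E) (hE : E ∈ D) (haE : img f E = E) :
    (F.generateAut D).IsMor f E := by
  obtain ⟨e, he, hef⟩ := ha.exists_mem_autF haE
  exact (mem_autF_iff hef).1 (F.autF_le_autF_generateAut hE he)

/-- The map `f` is a composite `aₙ ∘ ⋯ ∘ a₁` of `F`-automorphisms `aᵢ` of members of `D`, each
defined on the image of `A` under the preceding ones; a concrete form of the morphisms of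
`F.generateAut D`. -/
inductive IsComposite (F : FusionSystem S) (D : Set (Subgroup S)) (A : Subgroup S) :
    (S → S) → Prop
  | id : IsComposite F D A id
  | comp {f a : S → S} {E : Subgroup S} (hf : IsComposite F D A f) (hE : E ∈ D)
      (ha : F.IsMor a E) (haE : img a E = E) (hfE : img f A ≤ E) : IsComposite F D A (a ∘ f)

namespace IsComposite

theorem isMor (hf : IsComposite F D A f) : (F.generateAut D).IsMor f A := by
  induction hf with
  | id => exact isMor_id _ A
  | comp _ hE ha haE hfE ih => exact (ha.generateAut hE haE).comp ih hfE

theorem of_aut (hE : E ∈ D) (hf : F.IsMor f E) (hfE : img f E = E) (hA : A ≤ E) :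
    IsComposite F D A f :=
  id.comp hE hf hfE ((img_id A).trans_le hA)

theorem trans {g : S → S} (hf : IsComposite F D A f) (hg : IsComposite F D B g)
    (hB : img f A ≤ B) : IsComposite F D A (g ∘ f) := by
  induction hg with
  | id => exact hf
  | comp _ hE ha haE hgE ih =>
    refine ih.comp hE ha haE ?_
    rw [hf.isMor.img_comp]
    exact (img_mono _ hB).trans hgE

theorem exists_inverse (hf : IsComposite F D A f) :
    ∃ g, IsComposite F D (img f A) g ∧ ∀ x ∈ A, g (f x) = x := by
  induction hf with
  | id => exact ⟨_, id, fun _ _ => rfl⟩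
  | @comp f a E hf hE ha haE hfE ih =>
    obtain ⟨g, hg, hgf⟩ := ih
    obtain ⟨b, hb, hba, hbE⟩ := ha.exists_inverse
    rw [haE] at hb hbE
    have himg : img (a ∘ f) A ≤ E := by
      rw [hf.isMor.img_comp, ← haE]
      exact img_mono a hfE
    refine ⟨g ∘ b, (of_aut hE hb hbE himg).trans hg ?_, fun x hx => ?_⟩
    · rw [img_le_iff, hf.isMor.img_comp]
      intro y hy
      obtain ⟨x, hx, rfl⟩ := (ha.restrict hfE).mem_img.1 hy
      rwa [hba x (hfE hx)]
    · rw [Function.comp_apply, Function.comp_apply, hba _ (hfE (apply_mem_img f hx)), hgf x hx]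

end IsComposite

/-- The fusion system of all composites of restrictions of `F`-automorphisms of members of `D`.
Inner automorphisms of `S` are among them because `S` itself lies in `D`. -/
def compositeSystem (F : FusionSystem S) (hD : ⊤ ∈ D) : FusionSystem S where
  Hom A B := {φ | ∃ f, IsComposite F D A f ∧ ∀ x : A, (φ x : S) = f x}
  injective' φ hφ x y hxy := by
    obtain ⟨f, hf, hφf⟩ := hφ
    refine Subtype.ext (hf.isMor.injOn x.2 y.2 ?_)
    rw [← hφf, ← hφf, hxy]
  conj_mem' {A B} g φ h := by
    refine ⟨_, .of_aut hD (F.isMor_conj g⁻¹ ⊤) ?_ le_top, by simpa using h⟩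
    rw [img_conj]
    exact Subgroup.map_top_of_surjective _ (MulAut.conj g⁻¹).surjective
  comp_mem' φ ψ hφ hψ := by
    obtain ⟨f, hf, hφf⟩ := hφ
    obtain ⟨g, hg, hψg⟩ := hψ
    refine ⟨g ∘ f, hf.trans hg (img_le_iff.2 fun x hx => ?_), fun x => ?_⟩
    · exact hφf ⟨x, hx⟩ ▸ (φ ⟨x, hx⟩).2
    · rw [MonoidHom.comp_apply, hψg, hφf, Function.comp_apply]
  factor' {A B} φ hφ := by
    obtain ⟨f, hf, hφf⟩ := hφ
    obtain ⟨e, -, -, hef⟩ := hf.isMor.exists_mulEquiv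
    obtain ⟨g, hg, hgf⟩ := hf.exists_inverse
    refine ⟨img f A, img_le_iff.2 fun x hx => hφf ⟨x, hx⟩ ▸ (φ ⟨x, hx⟩).2, e,
      ⟨f, hf, hef⟩, ⟨g, hg, fun y => ?_⟩, ?_⟩
    · obtain ⟨x, rfl⟩ := e.surjective y
      rw [hef, hgf x x.2]
      exact congrArg Subtype.val (e.symm_apply_apply x)
    · exact MonoidHom.ext fun x => Subtype.ext ((hφf x).trans (hef x).symm)

theorem IsMor.exists_isComposite (hD : ⊤ ∈ D) (hf : (F.generateAut D).IsMor f A) :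
    ∃ g, IsComposite F D A g ∧ ∀ x ∈ A, f x = g x := by
  have hle : F.generateAut D ≤ F.compositeSystem hD := generate_le <| by
    rintro _ ⟨E, hE, a, ha, rfl⟩
    obtain ⟨f, hf⟩ := exists_forall_coe_eq a
    exact ⟨f, .of_aut hE ((mem_autF_iff hf).1 ha) (img_eq_of_mulEquiv a hf) le_rfl, hf⟩
  obtain ⟨φ, ⟨g, hg, hφg⟩, hφf⟩ := hf.mono hle
  exact ⟨g, hg, fun x hx => (hφf ⟨x, hx⟩).symm.trans (hφg ⟨x, hx⟩)⟩

end FusionSystem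

section

variable {p : ℕ} [Fact p.Prime] {G : Type*} [Group G] [Finite G]

theorem card_lt_card_of_lt {A B : Subgroup G} (h : A < B) : Nat.card A < Nat.card B :=
  Set.card_strictMono (SetLike.coe_ssubset_coe.2 h)

theorem exists_mem_normalizer_of_lt (hG : IsPGroup p G) {A E : Subgroup G} (h : A < E) :
    ∃ x ∈ E, x ∉ A ∧ x ∈ Subgroup.normalizer (A : Set G) := by
  have := (hG.to_subgroup E).isNilpotent
  have hlt : A.subgroupOf E < ⊤ :=
    lt_top_iff_ne_top.2 fun hc => h.not_ge (Subgroup.subgroupOf_eq_top.1 hc)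
  obtain ⟨x, hx, hxA⟩ := SetLike.exists_of_lt (Group.normalizerCondition_of_isNilpotent _ hlt)
  rw [← Subgroup.subgroupOf_normalizer_eq h.le] at hx
  exact ⟨x, x.2, hxA, hx⟩

theorem lt_normalizer_of_ne_top (hG : IsPGroup p G) {A : Subgroup G} (h : A ≠ ⊤) :
    A < Subgroup.normalizer (A : Set G) := by
  obtain ⟨x, -, hxA, hx⟩ := exists_mem_normalizer_of_lt hG (lt_top_iff_ne_top.2 h)
  exact SetLike.lt_iff_le_and_exists.2 ⟨Subgroup.le_normalizer, x, hx, hxA⟩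

theorem dvd_card_of_ne_bot {B : Subgroup G} (hB : IsPGroup p B) (h : B ≠ ⊥) : p ∣ Nat.card B := by
  obtain ⟨n, hn⟩ := hB.exists_card_eq
  rw [hn]
  refine dvd_pow_self p fun h0 => h (Subgroup.card_eq_one.1 ?_)
  rw [hn, h0, pow_zero]

open scoped Pointwise in
theorem exists_conj_mem_sylow {B : Sylow p G} {H : Subgroup G} (hBH : B ≤ H) {x : G} (hx : x ∈ H)
    (hxp : IsPGroup p (Subgroup.zpowers x)) : ∃ h ∈ H, h * x * h⁻¹ ∈ B := by
  obtain ⟨g, hg⟩ := exists_smul_le_sylow (B.subtype hBH) (U := (Subgroup.zpowers x).subgroupOf H)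
    (hxp.comap_of_injective H.subtype (Subgroup.subtype_injective _))
  exact ⟨g, g.2, hg (Subgroup.smul_mem_pointwise_smul (⟨x, hx⟩ : H) (MulAut.conj g) _
    (Subgroup.mem_zpowers x))⟩

theorem isStronglyEmbedded_of_sylow {B : Sylow p G} (hB : (B : Subgroup G) ≠ ⊥) {H : Subgroup G}
    (hBH : B ≤ H) (hH : H ≠ ⊤)
    (key : ∀ a u : G, u ∈ B → u ≠ 1 → a * u * a⁻¹ ∈ B → a ∈ H) : IsStronglyEmbedded p H := by
  refine ⟨hH, (dvd_card_of_ne_bot B.isPGroup' hB).trans (Subgroup.card_dvd_of_le hBH), ?_⟩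
  intro g hg hdvd
  obtain ⟨⟨x, hxH, y, hyH, hyx⟩, hord⟩ := exists_prime_orderOf_dvd_card' p hdvd
  rw [← Subgroup.orderOf_coe] at hord
  change orderOf x = p at hord
  replace hyx : g * y * g⁻¹ = x := hyx
  have hpgroup : ∀ z : G, orderOf z = p → IsPGroup p (Subgroup.zpowers z) := fun z hz =>
    IsPGroup.of_card (n := 1) (by rw [Nat.card_zpowers, hz, pow_one])
  have hy : orderOf y = p := by
    rw [← hord, ← hyx]
    exact ((MulAut.conj g).orderOf_eq y).symm
  obtain ⟨h, hh, hhx⟩ := exists_conj_mem_sylow hBH hxH (hpgroup x hord)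
  obtain ⟨k, hk, hky⟩ := exists_conj_mem_sylow hBH hyH (hpgroup y hy)
  have hmem : h * g * k⁻¹ ∈ H := by
    refine key _ (k * y * k⁻¹) hky (fun h1 => ?_) ?_
    · rw [conj_eq_one_iff] at h1
      exact (Fact.out : p.Prime).one_lt.ne (by rw [← hy, h1, orderOf_one])
    · convert hhx using 1
      rw [← hyx]
      group
  exact hg ((H.mul_mem_cancel_left hh).1 ((H.mul_mem_cancel_right (H.inv_mem hk)).1 hmem))

theorem isStronglyEmbedded_map_mk' (I : Subgroup G) [I.Normal] {B : Sylow p G}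
    (hIB : I < B) {H : Subgroup G} (hBH : B ≤ H) (hH : H ≠ ⊤)
    (key : ∀ a u : G, u ∈ B → u ∉ I → a * u * a⁻¹ ∈ B → a ∈ H) :
    IsStronglyEmbedded p (H.map (QuotientGroup.mk' I)) := by
  have hsurj := QuotientGroup.mk'_surjective I
  have hmem : ∀ {K : Subgroup G}, I ≤ K → ∀ {x : G},
      QuotientGroup.mk' I x ∈ K.map (QuotientGroup.mk' I) ↔ x ∈ K := by
    intro K hK x
    rw [← Subgroup.mem_comap, Subgroup.comap_map_eq, QuotientGroup.ker_mk', sup_eq_left.2 hK]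
  have hIH := hIB.le.trans hBH
  refine isStronglyEmbedded_of_sylow (B := B.mapSurjective hsurj) ?_ (Subgroup.map_mono hBH) ?_ ?_
  · obtain ⟨b, hb, hbI⟩ := SetLike.exists_of_lt hIB
    refine fun h => hbI ?_
    have hb' := Subgroup.mem_map_of_mem (QuotientGroup.mk' I) hb
    rw [← Sylow.coe_mapSurjective hsurj, h, Subgroup.mem_bot] at hb'
    rwa [← QuotientGroup.ker_mk' I]
  · exact fun h => hH ((Subgroup.eq_top_iff' H).2 fun x => (hmem hIH).1 (h ▸ Subgroup.mem_top _))
  · intro a _ hu hu1 hau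
    obtain ⟨u, hu, rfl⟩ := hu
    obtain ⟨a, rfl⟩ := hsurj a
    refine (hmem hIH).2 (key a u hu (fun hI => hu1 ?_) ?_)
    · rwa [← QuotientGroup.ker_mk' I] at hI
    · rw [← map_mul, ← map_inv, ← map_mul] at hau
      exact (hmem hIB.le).1 hau

end

namespace FusionSystem

variable {S : Type*} [Group S] {F G : FusionSystem S} {p : ℕ}

/-- `A` is `F`-conjugate to a subgroup of `P`. -/
def SubConj (F : FusionSystem S) (A P : Subgroup S) : Prop := ∃ B ≤ P, F.IsConj A B

namespace SubConj

variable {A B P : Subgroup S}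

theorem of_isConj (hAB : F.IsConj A B) (h : F.SubConj B P) : F.SubConj A P := by
  obtain ⟨C, hC, hBC⟩ := h
  exact ⟨C, hC, hAB.trans hBC⟩

theorem mono_left (h : F.SubConj B P) (hAB : A ≤ B) : F.SubConj A P := by
  obtain ⟨C, hC, hBC⟩ := h
  obtain ⟨f, hf, rfl⟩ := isConj_iff.1 hBC
  exact ⟨img f A, (img_mono f hAB).trans hC, (hf.restrict hAB).isConj⟩

theorem card_le [Finite S] (h : F.SubConj A P) : Nat.card A ≤ Nat.card P := by
  obtain ⟨B, hB, hAB⟩ := h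
  exact hAB.card_eq ▸ Subgroup.card_le_of_le hB

theorem isConj_of_card_le [Finite S] (h : F.SubConj A P) (hc : Nat.card P ≤ Nat.card A) :
    F.IsConj A P := by
  obtain ⟨B, hB, hAB⟩ := h
  obtain rfl := Subgroup.eq_of_le_of_card_ge hB (hAB.card_eq ▸ hc)
  exact hAB

end SubConj

theorem isSCentric_iff {A : Subgroup S} :
    IsSCentric A ↔ Subgroup.centralizer (A : Set S) ≤ A := by
  constructor
  · exact fun h => h.trans_le (Subgroup.map_subtype_le _)
  · refine fun h => le_antisymm (fun x hx => ?_) ?_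
    · exact ⟨⟨x, h hx⟩, Subgroup.mem_center_iff.2 fun y => Subtype.ext
        (Subgroup.mem_centralizer_iff.1 hx y y.2), rfl⟩
    · rintro _ ⟨x, hx, rfl⟩
      exact Subgroup.mem_centralizer_iff.2 fun y hy =>
        congrArg Subtype.val (Subgroup.mem_center_iff.1 hx ⟨y, hy⟩)

theorem mem_of_normalizerMonoidHom_mem_innAut {R : Subgroup S} (hR : IsSCentric R)
    {n : Subgroup.normalizer (R : Set S)} (h : Subgroup.normalizerMonoidHom R n ∈ innAut R) :
    (n : S) ∈ R := by
  obtain ⟨q, hq⟩ := h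
  have hconj : ∀ y ∈ R, (q : S) * y * (q : S)⁻¹ = n * y * (n : S)⁻¹ := fun y hy =>
    congrArg Subtype.val (DFunLike.congr_fun hq (⟨y, hy⟩ : R))
  have hcent : (q : S)⁻¹ * n ∈ Subgroup.centralizer (R : Set S) := by
    refine Subgroup.mem_centralizer_iff.2 fun y hy => ?_
    have h := hconj y hy
    calc y * ((q : S)⁻¹ * n) = (q : S)⁻¹ * (q * y * (q : S)⁻¹) * n := by group
      _ = (q : S)⁻¹ * n * y := by rw [h]; group
  exact (R.mul_mem_cancel_left (R.inv_mem q.2)).1 (isSCentric_iff.1 hR hcent)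

theorem innAut_le_autS (R : Subgroup S) : innAut R ≤ autS R := by
  rintro _ ⟨x, rfl⟩
  exact mem_autS_iff.2 ⟨x, Subgroup.le_normalizer x.2, fun y => rfl⟩

theorem innAut_lt_autS {R : Subgroup S} (hRC : IsSCentric R)
    (hR : R < Subgroup.normalizer (R : Set S)) : innAut R < autS R := by
  obtain ⟨n, hn, hnR⟩ := SetLike.exists_of_lt hR
  exact SetLike.lt_iff_le_and_exists.2 ⟨innAut_le_autS R,
    Subgroup.normalizerMonoidHom R ⟨n, hn⟩, ⟨_, rfl⟩,
    fun h => hnR (mem_of_normalizerMonoidHom_mem_innAut hRC h)⟩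

theorem centralizer_le_extControl {A B : Subgroup S} (e : A ≃* B) :
    Subgroup.centralizer (A : Set S) ≤ extControl e := by
  obtain ⟨f, hf⟩ := exists_forall_coe_eq e
  rw [← SetLike.coe_subset_coe, coe_extControl e hf]
  exact centralizer_subset_extSet f A

theorem isFullyNormalized_of_isReceptive [Finite S] [Fact p.Prime] (hS : IsPGroup p S)
    {R : Subgroup S} (ha : F.IsFullyAutomized p R) (hr : F.IsReceptive R) :
    F.IsFullyNormalized R := by
  intro Q hQ
  obtain ⟨k, hk, rfl⟩ := exists_isMor_normalizer hS ha hr hQ.symm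
  rw [← hk.card_img]
  exact Subgroup.card_le_of_le <| img_le_iff.2 fun x hx =>
    (hk.apply_mem_normalizer_iff Subgroup.le_normalizer hx).2 hx

theorem exists_isStronglyEmbedded_outF [Finite S] [Fact p.Prime] (hS : IsPGroup p S)
    {R : Subgroup S} (hR : R ≠ ⊤) (hRC : IsSCentric R) (ha : F.IsFullyAutomized p R)
    (hext : ∀ a ∈ F.autF R, ¬ extControl a ≤ R → a ∈ G.autF R) (hne : ¬ F.autF R ≤ G.autF R) :
    ∃ H : Subgroup (F.outF R), IsStronglyEmbedded p H := by
  obtain ⟨B, hB⟩ := ha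
  have hlt := innAut_lt_autS hRC (lt_normalizer_of_ne_top hS hR)
  have hmemB : ∀ u : F.autF R, u ∈ B ↔ (u : MulAut R) ∈ autS R := fun u => by
    rw [← Subgroup.mem_subgroupOf, ← hB]; exact Iff.rfl
  refine ⟨_, isStronglyEmbedded_map_mk' ((innAut R).subgroupOf (F.autF R)) (B := B) ?_
    (H := (G.autF R).subgroupOf (F.autF R)) ?_ (fun h => hne (Subgroup.subgroupOf_eq_top.1 h)) ?_⟩
  · obtain ⟨b, hb, hbR⟩ := SetLike.exists_of_lt hlt
    exact SetLike.lt_iff_le_and_exists.2 ⟨hB ▸ Subgroup.comap_mono hlt.le,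
      ⟨b, F.autS_le_autF R hb⟩, (hmemB _).2 hb, hbR⟩
  · exact hB ▸ Subgroup.comap_mono (G.autS_le_autF R)
  · intro a u hu huI hau
    obtain ⟨n, hn : Subgroup.normalizerMonoidHom R n = u⟩ := (hmemB u).1 hu
    refine hext a a.2 fun hle => huI ?_
    have hnR : (n : S) ∈ R := hle ⟨n,
      show (a : MulAut R) * R.normalizerMonoidHom n * (a : MulAut R)⁻¹ ∈ autS R by
      rw [hn]; exact (hmemB _).1 hau, rfl⟩
    have hconj : MulAut.conj (⟨n, hnR⟩ : R) = R.normalizerMonoidHom n :=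
      MulEquiv.ext fun _ => rfl
    exact ⟨_, hconj.trans hn⟩

/-- All `F`-morphisms defined on proper overgroups of `F`-conjugates of `R` lie in `G`: the
hypothesis of the induction step in Alperin's fusion theorem. -/
def ContainsAbove (F G : FusionSystem S) (R : Subgroup S) : Prop :=
  ∀ (A N : Subgroup S) (f : S → S), F.IsConj A R → A < N → F.IsMor f N → G.IsMor f N

namespace ContainsAbove

variable {R : Subgroup S}

theorem isConj [Finite S] [Fact p.Prime] (hS : IsPGroup p S) (h : ContainsAbove F G R)
    (hR : R ≠ ⊤) (ha : F.IsFullyAutomized p R) (hr : F.IsReceptive R) {A : Subgroup S}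
    (hAR : F.IsConj A R) : G.IsConj A R := by
  obtain ⟨k, hk, hkA⟩ := exists_isMor_normalizer hS ha hr hAR
  have hA : A < Subgroup.normalizer (A : Set S) := by
    refine lt_normalizer_of_ne_top hS ?_
    rintro rfl
    exact hR (Subgroup.eq_top_of_card_eq R (hAR.card_eq.trans Subgroup.card_top))
  exact isConj_iff.2 ⟨k, (h A _ k hAR hA hk).restrict hA.le, hkA⟩

theorem mem_autF (h : ContainsAbove F G R) (hr : F.IsReceptive R) {a : MulAut R}
    (ha : a ∈ F.autF R) (hext : ¬ extControl a ≤ R) : a ∈ G.autF R := by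
  obtain ⟨β, hβ, hβx⟩ := hr R a ha
  obtain ⟨k, hk⟩ := exists_forall_coe_eq β
  have hlt : R < extControl a := lt_of_le_not_ge (le_extControl a) hext
  refine (mem_autF_iff fun x => ?_).2
    ((h R _ k (.refl F R) hlt (isMor_of_mem_hom hβ hk)).restrict hlt.le)
  rw [← hβx x, hk, Subgroup.coe_inclusion]

theorem autF_le_of_not_isCentric (h : ContainsAbove F G R) (hr : F.IsReceptive R)
    (hcent : ¬ F.IsCentric R) : F.autF R ≤ G.autF R := by
  rw [IsCentric] at hcent
  push Not at hcent
  obtain ⟨A, hRA, hA⟩ := hcent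
  obtain ⟨x, hx, hxA⟩ := SetLike.not_le_iff_exists.1 (mt isSCentric_iff.2 hA)
  obtain ⟨g, hg, rfl⟩ := isConj_iff.1 hRA.symm
  obtain ⟨N, hN, k, hk, hkx⟩ := isReceptive_iff.1 hr A g hg rfl
  have hAN : A ≤ N := SetLike.coe_subset_coe.1 (hN ▸ hg.subset_extSet)
  have hxN : x ∈ N := SetLike.mem_coe.1 (hN ▸ centralizer_subset_extSet g A hx)
  have hkA : img k A = img g A := img_congr hkx
  refine fun a ha => h.mem_autF hr ha fun hle => hxA ?_
  rw [← hk.apply_mem_img_iff hAN hxN, hkA]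
  refine hle (centralizer_le_extControl a ?_)
  rw [← hkA]
  exact hk.apply_mem_centralizer hAN hxN hx

theorem isEssential [Finite S] [Fact p.Prime] (hS : IsPGroup p S) (h : ContainsAbove F G R)
    (hR : R ≠ ⊤) (ha : F.IsFullyAutomized p R) (hr : F.IsReceptive R)
    (hle : ¬ F.autF R ≤ G.autF R) : F.IsEssential p R := by
  have hcent : F.IsCentric R := by
    by_contra hcent
    exact hle (h.autF_le_of_not_isCentric hr hcent)
  exact ⟨lt_top_iff_ne_top.2 hR, hcent, isFullyNormalized_of_isReceptive hS ha hr,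
    exists_isStronglyEmbedded_outF hS hR (hcent R (.refl F R)) ha (fun _ => h.mem_autF hr) hle⟩

end ContainsAbove

theorem IsMor.of_autF_le {f : S → S} {Q R : Subgroup S} (hf : F.IsMor f Q) (hGF : G ≤ F)
    (hR : F.autF R ≤ G.autF R) (hQR : G.IsConj Q R) (hfQR : G.IsConj (img f Q) R) :
    G.IsMor f Q := by
  obtain ⟨k, hk, rfl⟩ := isConj_iff.1 hQR
  obtain ⟨l, hl, hlR⟩ := isConj_iff.1 hfQR
  obtain ⟨k', hk', hk'k, hk'R⟩ := hk.exists_inverse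
  obtain ⟨l', hl', hl'l, -⟩ := hl.exists_inverse
  have hfk' : F.IsMor (f ∘ k') (img k Q) := hf.comp (hk'.mono hGF) hk'R.le
  have himg : img (f ∘ k') (img k Q) = img f Q := by rw [hk'.img_comp, hk'R]
  have haut : F.IsMor (l ∘ f ∘ k') (img k Q) := (hl.mono hGF).comp hfk' himg.le
  have hautR : img (l ∘ f ∘ k') (img k Q) = img k Q := by rw [hfk'.img_comp, himg, hlR]
  obtain ⟨a, ha, hax⟩ := haut.exists_mem_autF hautR
  have hG : G.IsMor (l ∘ f ∘ k') (img k Q) := (mem_autF_iff hax).1 (hR ha)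
  rw [hlR] at hl'
  refine (hl'.comp (hG.comp hk le_rfl) ?_).congr fun x hx => ?_
  · rw [hk.img_comp, hautR]
  · simp only [Function.comp_apply]
    rw [hk'k x hx, hl'l _ (apply_mem_img f hx)]

theorem autF_le_autF_of_isConj {R E : Subgroup S} (hGF : G ≤ F) (hE : F.autF E ≤ G.autF E)
    (hRE : G.IsConj R E) : F.autF R ≤ G.autF R := by
  intro a ha
  obtain ⟨f, hf⟩ := exists_forall_coe_eq a
  refine (mem_autF_iff hf).2 (((mem_autF_iff hf).1 ha).of_autF_le hGF hE hRE ?_)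
  rwa [img_eq_of_mulEquiv a hf]

variable [Finite S] [Fact p.Prime]

theorem autF_le_autF_generateAut_of_containsAbove (hS : IsPGroup p S) {C : Set (Subgroup S)}
    (hC : F.IsEssentialReps p C) {P R : Subgroup S} (hR : R ≠ ⊤) (hRP : ¬ F.SubConj R P)
    (h : F.ContainsAbove (F.generateAut (insert ⊤ (C \ {P}))) R)
    (ha : F.IsFullyAutomized p R) (hr : F.IsReceptive R) :
    F.autF R ≤ (F.generateAut (insert ⊤ (C \ {P}))).autF R := by
  by_contra hle
  obtain ⟨E, ⟨hEC, hRE⟩, -⟩ := hC.2 R (h.isEssential hS hR ha hr hle)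
  have hEP : E ≠ P := by
    rintro rfl
    exact hRP ⟨E, le_rfl, hRE⟩
  exact hle (autF_le_autF_of_isConj (F.generateAut_le _)
    (F.autF_le_autF_generateAut (.inr ⟨hEC, hEP⟩)) (h.isConj hS hR ha hr hRE.symm).symm)

/-- **Alperin's fusion theorem**, relative to a subgroup `P`. -/
theorem IsMor.generateAut_of_not_subConj (hS : IsPGroup p S) (hF : F.IsSaturated p)
    {C : Set (Subgroup S)} (hC : F.IsEssentialReps p C) {P Q : Subgroup S}
    (hQ : ¬ F.SubConj Q P) {f : S → S} (hf : F.IsMor f Q) :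
    (F.generateAut (insert ⊤ (C \ {P}))).IsMor f Q := by
  induction hn : Nat.card S - Nat.card Q using Nat.strong_induction_on generalizing Q f with
  | _ n ih =>
  obtain ⟨R, hQR, ha, hr⟩ := hF Q
  have hcard := hQR.card_eq
  by_cases hR : R = ⊤
  · obtain rfl : Q = ⊤ :=
      Subgroup.eq_top_of_card_eq Q (by rw [← hcard, hR, Subgroup.card_top])
    exact hf.generateAut (.inl rfl) (Subgroup.eq_top_of_card_eq _
      (hf.card_img.trans Subgroup.card_top))
  have hRP : ¬ F.SubConj R P := fun h => hQ (.of_isConj hQR h)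
  have habove : F.ContainsAbove (F.generateAut (insert ⊤ (C \ {P}))) R := by
    intro A N g hAR hAN hg
    refine ih _ ?_ (fun hN => hRP (.of_isConj hAR.symm (hN.mono_left hAN.le))) hg rfl
    have := hAR.card_eq
    have := card_lt_card_of_lt hAN
    have := Subgroup.card_le_card_group N
    omega
  exact hf.of_autF_le (F.generateAut_le _)
    (autF_le_autF_generateAut_of_containsAbove hS hC hR hRP habove ha hr)
    (habove.isConj hS hR ha hr hQR)
    (habove.isConj hS hR ha hr (hf.isConj.symm.trans hQR))

end FusionSystem

section

open scoped Pointwise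

variable {p : ℕ} {X : Type*} [Group X]

/-- The action on `X ⧸ N` of the automorphisms of `X` that leave `N` invariant. -/
def quotientAut (N : Subgroup X) [N.Normal] :
    MulAction.stabilizer (MulAut X) N →* MulAut (X ⧸ N) where
  toFun a := QuotientGroup.congr N N a.1 a.2
  map_one' := MulEquiv.ext fun x => QuotientGroup.induction_on x fun _ => rfl
  map_mul' _ _ := MulEquiv.ext fun x => QuotientGroup.induction_on x fun _ => rfl

/-- The action on `V` of the automorphisms of `X` that leave `V` invariant. -/
def restrictAut (V : Subgroup X) : MulAction.stabilizer (MulAut X) V →* MulAut V where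
  toFun a := (a.1.subgroupMap V).trans (MulEquiv.subgroupCongr a.2)
  map_one' := rfl
  map_mul' _ _ := rfl

theorem card_smul (a : MulAut X) (V : Subgroup X) :
    Nat.card (a • V : Subgroup X) = Nat.card V :=
  (Nat.card_congr (Subgroup.equivSMul a V).toEquiv).symm

theorem smul_eq_self_of_smul_le [Finite X] {a : MulAut X} {V : Subgroup X} (h : a • V ≤ V) :
    a • V = V :=
  Subgroup.eq_of_le_of_card_ge h (card_smul a V).ge

theorem smul_eq_self_of_characteristic (a : MulAut X) (V : Subgroup X) [V.Characteristic] :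
    a • V = V :=
  Subgroup.characteristic_iff_map_eq.1 inferInstance a

theorem card_comap_mk' [Finite X] (N : Subgroup X) [N.Normal] (K : Subgroup (X ⧸ N)) :
    Nat.card (K.comap (QuotientGroup.mk' N)) = Nat.card K * Nat.card N := by
  have h := (K.comap (QuotientGroup.mk' N)).card_mul_index
  rw [Subgroup.index_comap_of_surjective _ (QuotientGroup.mk'_surjective N),
    ← N.card_mul_index, N.index_eq_card, ← K.card_mul_index, ← mul_assoc] at h
  exact (Nat.eq_of_mul_eq_mul_right (Nat.pos_of_ne_zero Subgroup.index_ne_zero_of_finite)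
    h).trans (mul_comm _ _)

theorem ncard_le_of_closure_pair_eq_top [Finite X] {T : Set (MulAut X)} {x v : X}
    (h : Subgroup.closure {x, v} = ⊤) {V W : Subgroup X} (hx : ∀ a ∈ T, x⁻¹ * a x ∈ V)
    (hv : ∀ a ∈ T, v⁻¹ * a v ∈ W) : T.ncard ≤ Nat.card V * Nat.card W := by
  rw [← Nat.card_prod, ← Nat.card_coe_set_eq]
  refine Nat.card_le_card_of_injective
    (fun a : T => ((⟨_, hx a a.2⟩ : V), (⟨_, hv a a.2⟩ : W))) fun a b hab => ?_
  simp only [Prod.mk.injEq, Subtype.mk.injEq, mul_right_inj] at hab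
  refine Subtype.ext (MulEquiv.toMonoidHom_injective (MonoidHom.eq_of_eqOn_dense h ?_))
  rintro _ (rfl | rfl)
  exacts [hab.1, hab.2]

theorem ncard_mul_sub_add_le_card [Finite X] {Ω : Set (Subgroup X)} {Z : Subgroup X} {m : ℕ}
    (hm : ∀ V ∈ Ω, Nat.card V = m) (hZ : ∀ V ∈ Ω, Z ≤ V)
    (hinf : ∀ V ∈ Ω, ∀ W ∈ Ω, V ≠ W → V ⊓ W ≤ Z) :
    Ω.ncard * (m - Nat.card Z) + Nat.card Z ≤ Nat.card X := by
  have hcard : ∀ V ∈ Ω, ((V : Set X) \ Z).ncard = m - Nat.card Z := fun V hV => by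
    rw [Set.ncard_sdiff (hZ V hV), ← hm V hV]
    rfl
  have hdisj : Ω.PairwiseDisjoint fun V => (V : Set X) \ Z := fun V hV W hW hVW =>
    Set.disjoint_left.2 fun x hxV hxW => hxV.2 (hinf V hV W hW hVW ⟨hxV.1, hxW.1⟩)
  have hunion : (⋃ V ∈ Ω, (V : Set X) \ Z).ncard = Ω.ncard * (m - Nat.card Z) := by
    rw [(Set.toFinite Ω).ncard_biUnion (fun _ _ => Set.toFinite _) hdisj,
      finsum_mem_congr rfl hcard, finsum_mem_eq_finite_toFinset_sum _ (Set.toFinite Ω),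
      Finset.sum_const, smul_eq_mul, Set.ncard_eq_toFinset_card]
  have hcompl : (Z : Set X)ᶜ.ncard + Nat.card Z = Nat.card X := by
    rw [add_comm]
    exact Set.ncard_add_ncard_compl (Z : Set X)
  rw [← hunion, ← hcompl]
  exact Nat.add_le_add_right (Set.ncard_le_ncard (Set.iUnion₂_subset fun V _ _ hx => hx.2)) _

theorem IsStronglyEmbedded.not_le_of_normal {H N : Subgroup X} (hH : IsStronglyEmbedded p H)
    [N.Normal] (hpN : p ∣ Nat.card N) : ¬ N ≤ H := by
  intro hNH
  obtain ⟨g, -, hg⟩ := SetLike.exists_of_lt (lt_top_iff_ne_top.2 hH.1)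
  refine hH.2.2 g hg (hpN.trans (Subgroup.card_dvd_of_le (le_inf hNH ?_)))
  rw [← Subgroup.Normal.map_conj_eq N g]
  exact Subgroup.map_mono hNH

theorem card_innAut : Nat.card (innAut X) = (Subgroup.center X).index := by
  have hker : (MulAut.conj : X →* MulAut X).ker = Subgroup.center X := by
    ext x
    simp only [MonoidHom.mem_ker, Subgroup.mem_center_iff, MulEquiv.ext_iff, MulAut.conj_apply,
      MulAut.one_apply, mul_inv_eq_iff_eq_mul]
    exact forall_congr' fun y => eq_comm
  rw [← hker, Subgroup.index_ker]
  rfl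

theorem normal_of_ncard_le [Finite X] {T : Subgroup X} (hT : IsPGroup p T)
    (h : {x : X | IsPGroup p (Subgroup.zpowers x)}.ncard ≤ Nat.card T) : T.Normal := by
  have hmem : ∀ x, x ∈ T ↔ IsPGroup p (Subgroup.zpowers x) := Set.ext_iff.1 <|
    Set.eq_of_subset_of_ncard_le (t := {x : X | IsPGroup p (Subgroup.zpowers x)})
      (fun x hx => hT.to_le (Subgroup.zpowers_le.2 hx)) h (Set.toFinite _)
  refine ⟨fun x hx g => ?_⟩
  rw [hmem, ← MulAut.conj_apply, ← MulEquiv.coe_toMonoidHom, ← MonoidHom.map_zpowers]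
  exact ((hmem x).1 hx).map _

theorem card_mul_le_card_of_lt [Finite X] [Fact p.Prime] (hX : IsPGroup p X) {A B : Subgroup X}
    (h : A < B) : Nat.card A * p ≤ Nat.card B := by
  have hp : p.Prime := Fact.out
  obtain ⟨m, hm⟩ := (hX.to_subgroup A).exists_card_eq
  obtain ⟨n, hn⟩ := (hX.to_subgroup B).exists_card_eq
  have hlt := card_lt_card_of_lt h
  rw [hm, hn] at hlt ⊢
  rw [← pow_succ]
  exact Nat.pow_le_pow_right hp.pos ((Nat.pow_lt_pow_iff_right hp.one_lt).1 hlt)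

end

section

open scoped Pointwise

variable {p : ℕ} [Fact p.Prime] {X : Type*} [Group X]

theorem index_eq_of_card_eq_pow {V : Subgroup X} {n : ℕ} (hX : Nat.card X = p ^ (n + 1))
    (hV : Nat.card V = p ^ n) : V.index = p := by
  have h := V.card_mul_index
  rw [hV, hX, pow_succ] at h
  exact Nat.eq_of_mul_eq_mul_left (pow_pos (Fact.out : p.Prime).pos n) h

variable [Finite X]

theorem exists_orderOf_eq_forall_apply_eq (hX : p ∣ Nat.card X) {U : Subgroup (MulAut X)}
    (hU : IsPGroup p U) : ∃ z : X, orderOf z = p ∧ ∀ a ∈ U, a z = z := by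
  have hdvd : p ∣ Nat.card (FixedPoints.subgroup U X) :=
    (hU.card_modEq_card_fixedPoints X).dvd_iff dvd_rfl |>.1 hX
  obtain ⟨z, hz⟩ := exists_prime_orderOf_dvd_card' p hdvd
  exact ⟨z, (Subgroup.orderOf_coe z).trans hz, fun a ha => z.2 ⟨a, ha⟩⟩

theorem eq_bot_of_card_eq_prime (hX : Nat.card X = p) {U : Subgroup (MulAut X)}
    (hU : IsPGroup p U) : U = ⊥ := by
  obtain ⟨z, hz, hUz⟩ := exists_orderOf_eq_forall_apply_eq hX.symm.dvd hU
  have htop : Subgroup.closure {z} = ⊤ := by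
    rw [← Subgroup.zpowers_eq_closure]
    exact Subgroup.eq_top_of_card_eq _ ((Nat.card_zpowers z).trans (hz.trans hX.symm))
  refine (Subgroup.eq_bot_iff_forall U).2 fun a ha =>
    MulEquiv.toMonoidHom_injective (MonoidHom.eq_of_eqOn_dense htop ?_)
  rintro _ rfl
  exact hUz a ha

theorem inv_mul_apply_mem_of_index_eq {N : Subgroup X} [N.Normal] (hN : N.index = p)
    {a : MulAut X} (ha : IsPGroup p (Subgroup.zpowers a)) (haN : a • N = N) (x : X) :
    x⁻¹ * a x ∈ N := by
  have hbot := eq_bot_of_card_eq_prime hN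
    ((ha.comap_of_injective (Subgroup.subtype _) (Subgroup.subtype_injective _)).map
      (quotientAut N))
  have hone : quotientAut N ⟨a, haN⟩ = 1 := (Subgroup.eq_bot_iff_forall _).1 hbot _
    (Subgroup.mem_map_of_mem _ (Subgroup.mem_zpowers a))
  exact QuotientGroup.eq.1 (DFunLike.congr_fun hone (x : X ⧸ N)).symm

theorem eq_top_of_lt_of_card_eq_pow {V L : Subgroup X} {n : ℕ} (hX : Nat.card X = p ^ (n + 1))
    (hV : Nat.card V = p ^ n) (h : V < L) : L = ⊤ := by
  refine Subgroup.eq_top_of_le_card L ?_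
  rw [hX, pow_succ, ← hV]
  exact card_mul_le_card_of_lt (.of_card hX) h

theorem normal_of_card_eq_pow {V : Subgroup X} {n : ℕ} (hX : Nat.card X = p ^ (n + 1))
    (hV : Nat.card V = p ^ n) : V.Normal := by
  refine Subgroup.normalizer_eq_top_iff.1
    (eq_top_of_lt_of_card_eq_pow hX hV (lt_normalizer_of_ne_top (.of_card hX) ?_))
  rintro rfl
  rw [Subgroup.card_top, hX] at hV
  exact (Nat.pow_right_injective (Fact.out : p.Prime).two_le hV).not_gt n.lt_succ_self

theorem inv_mul_apply_mem_of_card_eq_pow {N V : Subgroup X} {n : ℕ} (hNV : N ≤ V)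
    (hV : Nat.card V = p ^ (n + 1)) (hN : Nat.card N = p ^ n) {a : MulAut X}
    (ha : IsPGroup p (Subgroup.zpowers a)) (haN : a • N = N) (haV : a • V = V) {v : X}
    (hv : v ∈ V) : v⁻¹ * a v ∈ N := by
  have hN' : Nat.card (N.subgroupOf V) = p ^ n :=
    (Nat.card_congr (Subgroup.subgroupOfEquivOfLe hNV).toEquiv).trans hN
  have := normal_of_card_eq_pow hV hN'
  have hb : IsPGroup p (Subgroup.zpowers (restrictAut V ⟨a, haV⟩)) :=
    ((ha.comap_of_injective (Subgroup.subtype _) (Subgroup.subtype_injective _)).map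
      (restrictAut V)).to_le (Subgroup.zpowers_le.2
        (Subgroup.mem_map_of_mem _ (Subgroup.mem_zpowers a)))
  refine inv_mul_apply_mem_of_index_eq (index_eq_of_card_eq_pow hV hN') hb
    (smul_eq_self_of_smul_le ?_) (⟨v, hv⟩ : V)
  rintro _ ⟨x, hx, rfl⟩
  exact haN.le (Subgroup.smul_mem_pointwise_smul (x : X) a N hx)

theorem card_le_of_card_eq_sq (hX : Nat.card X = p ^ 2) {U : Subgroup (MulAut X)}
    (hU : IsPGroup p U) : Nat.card U ≤ p := by
  obtain ⟨z, hz, hUz⟩ := exists_orderOf_eq_forall_apply_eq (hX ▸ dvd_pow_self p two_ne_zero) hU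
  have hN : Nat.card (Subgroup.zpowers z) = p ^ 1 := by rw [Nat.card_zpowers, hz, pow_one]
  have := normal_of_card_eq_pow hX hN
  have hlt : Subgroup.zpowers z < ⊤ := lt_top_iff_ne_top.2 fun h => by
    rw [h, Subgroup.card_top, hX] at hN
    exact absurd (Nat.pow_right_injective (Fact.out : p.Prime).two_le hN) (by norm_num)
  obtain ⟨x, -, hx⟩ := SetLike.exists_of_lt hlt
  have htop : Subgroup.closure {x, z} = ⊤ := eq_top_of_lt_of_card_eq_pow hX hN <|
    SetLike.lt_iff_le_and_exists.2 ⟨Subgroup.zpowers_le.2 (Subgroup.subset_closure (.inr rfl)), x,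
      Subgroup.subset_closure (.inl rfl), hx⟩
  have hUN : ∀ a ∈ U, a • Subgroup.zpowers z = Subgroup.zpowers z := fun a ha =>
    (MonoidHom.map_zpowers (a : X →* X) z).trans (congrArg _ (hUz a ha))
  have hdisp : ∀ a ∈ U, x⁻¹ * a x ∈ Subgroup.zpowers z := fun a ha =>
    inv_mul_apply_mem_of_index_eq (index_eq_of_card_eq_pow hX hN)
      (hU.to_le (Subgroup.zpowers_le.2 ha)) (hUN a ha) x
  have hfix : ∀ a ∈ U, z⁻¹ * a z ∈ (⊥ : Subgroup X) := fun a ha => by simp [hUz a ha]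
  have hle := ncard_le_of_closure_pair_eq_top (T := U) htop hdisp hfix
  rwa [hN, pow_one, Subgroup.card_bot, mul_one] at hle

theorem exists_card_eq_mul_forall_smul_eq {N : Subgroup X} [N.Normal] (hN : p ∣ N.index)
    {U : Subgroup (MulAut X)} (hU : IsPGroup p U) (hUN : ∀ a ∈ U, a • N = N) :
    ∃ V : Subgroup X, Nat.card V = p * Nat.card N ∧ ∀ a ∈ U, a • V = V := by
  obtain ⟨q, hq, hUq⟩ := exists_orderOf_eq_forall_apply_eq (X := X ⧸ N) hN
    ((hU.comap_of_injective (Subgroup.subtype _) (Subgroup.subtype_injective _)).map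
      (quotientAut N))
  refine ⟨(Subgroup.zpowers q).comap (QuotientGroup.mk' N), ?_, fun a ha =>
    smul_eq_self_of_smul_le ?_⟩
  · rw [card_comap_mk', Nat.card_zpowers, hq]
  · rintro _ ⟨x, ⟨n, hn : q ^ n = x⟩, rfl⟩
    have hqa := hUq _ (Subgroup.mem_map_of_mem (quotientAut N)
      (x := (⟨a, hUN a ha⟩ : MulAction.stabilizer (MulAut X) N)) ha)
    exact ⟨n, show q ^ n = quotientAut N ⟨a, hUN a ha⟩ (x : X ⧸ N) by
      rw [← hn, map_zpow, hqa]⟩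

theorem le_ncard_orbit {M α : Type*} [Group M] [MulAction M α] [Finite α] (hM : IsPGroup p M)
    {x : α} (hx : ∃ g : M, g • x ≠ x) : p ≤ (MulAction.orbit M x).ncard := by
  obtain ⟨n, hn⟩ := hM.card_orbit x
  rw [← Nat.card_coe_set_eq, hn]
  refine Nat.le_self_pow ?_ p
  rintro rfl
  obtain ⟨g, hg⟩ := hx
  have := (Nat.card_eq_one_iff_unique.1 hn).1
  exact hg (congrArg Subtype.val (Subsingleton.elim
    (⟨_, MulAction.mem_orbit x g⟩ : MulAction.orbit M x) ⟨x, MulAction.mem_orbit_self x⟩))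

end

/-- `X` is a non-abelian group of order `p ^ 3`; the pearls that do not have order `p ^ 2` are of
this kind. -/
def IsNonabelianCube (p : ℕ) (X : Type*) [Group X] : Prop :=
  Nat.card X = p ^ 3 ∧ ¬ ∀ x y : X, x * y = y * x

namespace IsNonabelianCube

open scoped Pointwise

theorem of_mulEquiv {p : ℕ} {X Y : Type*} [Group X] [Group Y] (hX : IsNonabelianCube p X)
    (e : X ≃* Y) : IsNonabelianCube p Y := by
  refine ⟨(Nat.card_congr e.toEquiv).symm.trans hX.1, fun h => hX.2 fun x y => e.injective ?_⟩
  rw [map_mul, map_mul, h]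

variable {p : ℕ} [Fact p.Prime] {X : Type*} [Group X]

theorem card_center (hX : IsNonabelianCube p X) : Nat.card (Subgroup.center X) = p := by
  have hp : p.Prime := Fact.out
  obtain ⟨k, hk, hkc⟩ := IsPGroup.card_center_eq_prime_pow hX.1 (by norm_num)
  suffices hk1 : k ≤ 1 by rw [hkc, le_antisymm hk1 hk, pow_one]
  by_contra! hk2
  have hdvd : p ^ 2 * Nat.card (X ⧸ Subgroup.center X) ∣ p ^ 2 * p := by
    rw [← pow_succ, ← hX.1, ← Subgroup.card_mul_index (Subgroup.center X), hkc]
    exact mul_dvd_mul_right (pow_dvd_pow p hk2) _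
  have := isCyclic_of_card_dvd_prime (Nat.dvd_of_mul_dvd_mul_left (pow_pos hp.pos 2) hdvd)
  exact hX.2 (isMulCommutative_of_isCyclic_quotient_center_self X).is_comm.comm

theorem index_center (hX : IsNonabelianCube p X) : (Subgroup.center X).index = p ^ 2 := by
  have h := (Subgroup.center X).card_mul_index
  rw [hX.card_center, hX.1, pow_succ'] at h
  exact Nat.eq_of_mul_eq_mul_left (Fact.out : p.Prime).pos h

variable [Finite X]

theorem closure_pair_eq_top (hX : IsNonabelianCube p X) {x v : X} (h : x * v ≠ v * x) :
    Subgroup.closure {x, v} = ⊤ := by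
  by_contra hne
  obtain ⟨n, hn⟩ := ((IsPGroup.of_card hX.1).to_subgroup (Subgroup.closure {x, v})).exists_card_eq
  have hle := card_mul_le_card_of_lt (.of_card hX.1) (lt_top_iff_ne_top.2 hne)
  rw [hn, Subgroup.card_top, hX.1, ← pow_succ,
    Nat.pow_le_pow_iff_right (Fact.out : p.Prime).one_lt] at hle
  obtain ⟨K, hK, hLK⟩ := Sylow.exists_subgroup_card_pow_prime_le p
    (hX.1 ▸ pow_dvd_pow p (by norm_num : 2 ≤ 3)) _ hn (by omega)
  have := IsPGroup.isMulCommutative_of_card_eq_prime_sq hK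
  exact h (setLike_mul_comm (hLK (Subgroup.subset_closure (.inl rfl)))
    (hLK (Subgroup.subset_closure (.inr rfl))))

theorem center_lt (hX : IsNonabelianCube p X) {V : Subgroup X} (hV : Nat.card V = p ^ 2) :
    Subgroup.center X < V := by
  have hp : p.Prime := Fact.out
  have := IsPGroup.isMulCommutative_of_card_eq_prime_sq hV
  have hlt : Nat.card (Subgroup.center X) < Nat.card V := by
    rw [hX.card_center, hV]
    exact lt_self_pow₀ hp.one_lt one_lt_two
  suffices hle : Subgroup.center X ≤ V from lt_of_le_of_ne hle fun h => hlt.ne (h ▸ rfl)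
  by_contra hle
  have htop : V ⊔ Subgroup.center X = ⊤ :=
    eq_top_of_lt_of_card_eq_pow hX.1 hV (left_lt_sup.2 hle)
  refine hlt.not_ge (Subgroup.card_le_of_le fun v hv => Subgroup.mem_center_iff.2 fun x => ?_)
  have hsup : V ⊔ Subgroup.center X ≤ Subgroup.centralizer {v} := by
    refine sup_le (fun w hw => Subgroup.mem_centralizer_singleton_iff.2 ?_)
      (fun z hz => Subgroup.mem_centralizer_singleton_iff.2 ?_)
    · exact setLike_mul_comm hw hv
    · exact (Subgroup.mem_center_iff.1 hz v).symm
  exact Subgroup.mem_centralizer_singleton_iff.1 (hsup (htop ▸ Subgroup.mem_top x))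

theorem inf_le_center (hX : IsNonabelianCube p X) {V W : Subgroup X} (hV : Nat.card V = p ^ 2)
    (hW : Nat.card W = p ^ 2) (hVW : V ≠ W) : V ⊓ W ≤ Subgroup.center X := by
  by_contra hle
  have hlt : Subgroup.center X < V ⊓ W :=
    (le_inf (hX.center_lt hV).le (hX.center_lt hW).le).lt_of_not_ge hle
  have hcard := card_mul_le_card_of_lt (.of_card hX.1) hlt
  rw [hX.card_center, ← pow_two] at hcard
  exact hVW ((Subgroup.eq_of_le_of_card_ge inf_le_left (hV.trans_le hcard)).symm.trans
    (Subgroup.eq_of_le_of_card_ge inf_le_right (hW.trans_le hcard)))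

theorem ncard_subgroups_le (hX : IsNonabelianCube p X) :
    {V : Subgroup X | Nat.card V = p ^ 2}.ncard ≤ p + 1 := by
  have hp := (Fact.out : p.Prime).one_lt
  have h := ncard_mul_sub_add_le_card (Ω := {V : Subgroup X | Nat.card V = p ^ 2})
    (Z := Subgroup.center X) (fun _ hV => hV) (fun _ hV => (hX.center_lt hV).le)
    (fun _ hV _ hW => hX.inf_le_center hV hW)
  rw [hX.card_center, hX.1] at h
  have hcube : (p + 1) * (p ^ 2 - p) + p = p ^ 3 := by
    zify [(lt_self_pow₀ hp one_lt_two).le]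
    ring
  rw [← hcube] at h
  exact Nat.le_of_mul_le_mul_right (Nat.le_of_add_le_add_right h)
    (Nat.sub_pos_of_lt (lt_self_pow₀ hp one_lt_two))

theorem ncard_le_of_smul_eq (hX : IsNonabelianCube p X) {V : Subgroup X}
    (hV : Nat.card V = p ^ 2) :
    {a : MulAut X | IsPGroup p (Subgroup.zpowers a) ∧ a • V = V}.ncard ≤ p ^ 3 := by
  obtain ⟨v, hv, hvZ⟩ := SetLike.exists_of_lt (hX.center_lt hV)
  rw [Subgroup.mem_center_iff] at hvZ
  push Not at hvZ
  obtain ⟨x, hx⟩ := hvZ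
  have hZ : Nat.card (Subgroup.center X) = p ^ 1 := hX.card_center.trans (pow_one p).symm
  have := normal_of_card_eq_pow hX.1 hV
  have h := ncard_le_of_closure_pair_eq_top
    (T := {a : MulAut X | IsPGroup p (Subgroup.zpowers a) ∧ a • V = V})
    (hX.closure_pair_eq_top hx) (V := V) (W := Subgroup.center X)
    (fun a ha => inv_mul_apply_mem_of_index_eq (index_eq_of_card_eq_pow hX.1 hV) ha.1 ha.2 x)
    (fun a ha => inv_mul_apply_mem_of_card_eq_pow (hX.center_lt hV).le hV hZ ha.1
      (smul_eq_self_of_characteristic a _) ha.2 hv)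
  rwa [hV, hX.card_center, ← pow_succ] at h

theorem exists_card_eq_sq_forall_smul_eq (hX : IsNonabelianCube p X) {U : Subgroup (MulAut X)}
    (hU : IsPGroup p U) : ∃ V : Subgroup X, Nat.card V = p ^ 2 ∧ ∀ a ∈ U, a • V = V := by
  have h := exists_card_eq_mul_forall_smul_eq (N := Subgroup.center X)
    (hX.index_center ▸ dvd_pow_self p two_ne_zero) hU
    fun a _ => smul_eq_self_of_characteristic a _
  rwa [hX.card_center, ← pow_two] at h

theorem card_le_of_isPGroup (hX : IsNonabelianCube p X) {U : Subgroup (MulAut X)}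
    (hU : IsPGroup p U) : Nat.card U ≤ p ^ 3 := by
  obtain ⟨V, hV, hUV⟩ := hX.exists_card_eq_sq_forall_smul_eq hU
  have hsub : (U : Set (MulAut X)) ⊆
      {a : MulAut X | IsPGroup p (Subgroup.zpowers a) ∧ a • V = V} :=
    fun a ha => ⟨hU.to_le (Subgroup.zpowers_le.2 ha), hUV a ha⟩
  exact (Set.ncard_le_ncard hsub (Set.toFinite _)).trans (hX.ncard_le_of_smul_eq hV)

theorem exists_smul_ne (hX : IsNonabelianCube p X) {A : Subgroup (MulAut X)} (hA : innAut X ≤ A)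
    {H : Subgroup (A ⧸ (innAut X).subgroupOf A)} (hH : IsStronglyEmbedded p H)
    {V : Subgroup X} (hV : Nat.card V = p ^ 2) : ∃ a ∈ A, a • V ≠ V := by
  by_contra! hAV
  set I := (innAut X).subgroupOf A with hI
  obtain ⟨⟨x, hxH⟩, hx⟩ := exists_prime_orderOf_dvd_card' p hH.2.1
  rw [← Subgroup.orderOf_coe] at hx
  have hxp : Nat.card (Subgroup.zpowers x) = p := (Nat.card_zpowers x).trans hx
  have hsurj := QuotientGroup.mk'_surjective I
  have hTcard : Nat.card ((Subgroup.zpowers x).comap (QuotientGroup.mk' I)) = p ^ 3 := by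
    rw [card_comap_mk', hxp, hI, Nat.card_congr (Subgroup.subgroupOfEquivOfLe hA).toEquiv,
      card_innAut, hX.index_center, ← pow_succ']
  have hT : ((Subgroup.zpowers x).comap (QuotientGroup.mk' I)).Normal := by
    refine normal_of_ncard_le (.of_card hTcard) (hTcard ▸ ?_)
    rw [← Set.ncard_image_of_injective _ (Subgroup.subtype_injective A)]
    refine (Set.ncard_le_ncard ?_ (Set.toFinite _)).trans (hX.ncard_le_of_smul_eq hV)
    rintro _ ⟨a, ha, rfl⟩
    refine ⟨?_, hAV a a.2⟩
    rw [← MonoidHom.map_zpowers]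
    exact IsPGroup.map ha _
  have hN : (Subgroup.zpowers x).Normal := by
    rw [← Subgroup.map_comap_eq_self_of_surjective hsurj (Subgroup.zpowers x)]
    exact hT.map _ hsurj
  exact hH.not_le_of_normal hxp.symm.dvd (Subgroup.zpowers_le.2 hxH)

theorem exists_forall_smul_smul_eq (hX : IsNonabelianCube p X) {A : Subgroup (MulAut X)}
    (hA : innAut X ≤ A) {H : Subgroup (A ⧸ (innAut X).subgroupOf A)}
    (hH : IsStronglyEmbedded p H) {U : Subgroup (MulAut X)} (hU : IsPGroup p U) (hUA : U ≤ A)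
    {R : Subgroup X} (hR : Nat.card R = p ^ 2) : ∃ b ∈ A, ∀ u ∈ U, u • b • R = b • R := by
  by_contra! hc
  obtain ⟨V, hV, hUV⟩ := hX.exists_card_eq_sq_forall_smul_eq hU
  obtain ⟨a, ha, haV⟩ := hX.exists_smul_ne hA hH hV
  have hRV : ∀ b ∈ A, b • R ≠ V := by
    rintro b hb rfl
    obtain ⟨u, hu, hub⟩ := hc b hb
    exact hub (hUV u hu)
  have horb : p ≤ (MulAction.orbit U R).ncard := by
    obtain ⟨u, hu, hub⟩ := hc 1 A.one_mem
    exact le_ncard_orbit hU ⟨⟨u, hu⟩, by rwa [one_smul] at hub⟩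
  have hV₁ : V ∉ MulAction.orbit U R := by
    rintro ⟨u, hu⟩
    exact hRV u (hUA u.2) hu
  have hV₂ : a • V ∉ insert V (MulAction.orbit U R) := by
    rintro (h | ⟨u, hu⟩)
    · exact haV h
    · refine hRV (a⁻¹ * u) (A.mul_mem (A.inv_mem ha) (hUA u.2)) ?_
      rw [mul_smul, inv_smul_eq_iff]
      exact hu
  have hsub : insert (a • V) (insert V (MulAction.orbit U R)) ⊆
      {V : Subgroup X | Nat.card V = p ^ 2} := by
    rintro W (rfl | rfl | ⟨u, rfl⟩)
    · exact (card_smul a V).trans hV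
    · exact hV
    · exact (card_smul (u : MulAut X) R).trans hR
  have hle := (Set.ncard_le_ncard hsub (Set.toFinite _)).trans hX.ncard_subgroups_le
  rw [Set.ncard_insert_of_notMem hV₂ (Set.toFinite _),
    Set.ncard_insert_of_notMem hV₁ (Set.toFinite _)] at hle
  omega

end IsNonabelianCube

namespace FusionSystem

variable {S : Type*} [Group S] {F : FusionSystem S} {p : ℕ} {C D Y : Set (Subgroup S)}
  {f : S → S} {A P Q R : Subgroup S}

/-- The saturation axiom for the single subgroup `Q`. -/
def IsSaturatedAt (F : FusionSystem S) (p : ℕ) (Q : Subgroup S) : Prop :=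
  ∃ R, F.IsConj Q R ∧ F.IsFullyAutomized p R ∧ F.IsReceptive R

theorem IsMor.exists_coe_eq_extSet (hf : F.IsMor f A) :
    ∃ N : Subgroup S, (N : Set S) = extSet f A := by
  obtain ⟨e, -, -, he⟩ := hf.exists_mulEquiv
  exact ⟨extControl e, coe_extControl e he⟩

/-- A set `Y` of subgroups of `S` on which all morphisms composed of `F`-automorphisms of members
of `D` extend to normalizers, because each such automorphism that is defined on a member of `Y` is
defined on its normalizer. -/
def IsNormalizerStable (F : FusionSystem S) (D Y : Set (Subgroup S)) : Prop :=
  ∀ R ∈ Y, ∀ E ∈ D, R ≤ E → Subgroup.normalizer (R : Set S) ≤ E ∧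
    ∀ a, F.IsMor a E → img a E = E → img a R ∈ Y

namespace IsNormalizerStable

theorem exists_extension_of_isComposite (hY : F.IsNormalizerStable D Y) (hA : A ∈ Y)
    (hf : IsComposite F D A f) :
    img f A ∈ Y ∧ ∃ k, (F.generateAut D).IsMor k (Subgroup.normalizer (A : Set S)) ∧
      ∀ x ∈ A, k x = f x := by
  induction hf with
  | id => exact ⟨(img_id A).symm ▸ hA, id, isMor_id _ _, fun _ _ => rfl⟩
  | @comp f a E hf hE ha haE hfE ih =>
    obtain ⟨hfY, k, hk, hkx⟩ := ih
    obtain ⟨hNE, hEY⟩ := hY _ hfY E hE hfE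
    refine ⟨(hf.isMor.img_comp a) ▸ hEY a ha haE, a ∘ k, ?_, fun x hx => congrArg a (hkx x hx)⟩
    refine (ha.generateAut hE haE).comp hk (img_le_iff.2 fun x hx => hNE ?_)
    rw [← img_congr hkx]
    exact (hk.apply_mem_normalizer_iff Subgroup.le_normalizer hx).2 hx

theorem exists_extension (hY : F.IsNormalizerStable D Y) (hD : ⊤ ∈ D) (hA : A ∈ Y)
    (hf : (F.generateAut D).IsMor f A) :
    img f A ∈ Y ∧ ∃ k, (F.generateAut D).IsMor k (Subgroup.normalizer (A : Set S)) ∧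
      ∀ x ∈ A, k x = f x := by
  obtain ⟨g, hg, hfg⟩ := hf.exists_isComposite hD
  obtain ⟨hgY, k, hk, hkx⟩ := hY.exists_extension_of_isComposite hA hg
  exact ⟨img_congr hfg ▸ hgY, k, hk, fun x hx => (hkx x hx).trans (hfg x hx).symm⟩

theorem mem_of_isConj (hY : F.IsNormalizerStable D Y) (hD : ⊤ ∈ D)
    (h : (F.generateAut D).IsConj A R) (hA : A ∈ Y) : R ∈ Y := by
  obtain ⟨f, hf, rfl⟩ := isConj_iff.1 h
  exact (hY.exists_extension hD hA hf).1

theorem isReceptive (hY : F.IsNormalizerStable D Y) (hD : ⊤ ∈ D) (hQ : Q ∈ Y) :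
    (F.generateAut D).IsReceptive Q := by
  refine isReceptive_iff.2 fun A f hf hfA => ?_
  have hA : A ∈ Y := hY.mem_of_isConj hD (isConj_iff.2 ⟨f, hf, hfA⟩).symm hQ
  obtain ⟨-, k, hk, hkx⟩ := hY.exists_extension hD hA hf
  obtain ⟨N, hN⟩ := hf.exists_coe_eq_extSet
  exact ⟨N, hN, k,
    hk.restrict (SetLike.coe_subset_coe.1 (hN.trans_subset (extSet_subset_normalizer f A))), hkx⟩

end IsNormalizerStable

/-- Neither `N_S(A)` nor any proper overgroup of `A` of the form `N_α` is `F`-conjugate to a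
subgroup of `P`. By Alperin's theorem, the extension properties of `A` then survive the removal of
the class of `P` from the essential subgroups. -/
def IsDetached (F : FusionSystem S) (P A : Subgroup S) : Prop :=
  ¬ F.SubConj (Subgroup.normalizer (A : Set S)) P ∧
    ∀ f, F.IsMor f A → ∀ N : Subgroup S, (N : Set S) = extSet f A → F.SubConj N P → N = A

/-- `A` can be moved by a morphism of `⟨Aut_F(E) | E ∈ D⟩` defined on `N_S(A)` to a subgroup
detached from `P`. -/
def IsDetachable (F : FusionSystem S) (D : Set (Subgroup S)) (P A : Subgroup S) : Prop :=
  ∃ χ, (F.generateAut D).IsMor χ (Subgroup.normalizer (A : Set S)) ∧ F.IsDetached P (img χ A)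

theorem IsDetached.isDetachable (h : F.IsDetached P A) : F.IsDetachable D P A :=
  ⟨id, isMor_id _ _, by rwa [img_id]⟩

theorem IsMor.image_extSet_subset {l χ : S → S}
    (hχ : F.IsMor χ (Subgroup.normalizer (A : Set S))) (hl : ∀ x ∈ A, l (χ x) = x)
    (himg : img (f ∘ l) (img χ A) = img f A) : χ '' extSet f A ⊆ extSet (f ∘ l) (img χ A) := by
  rintro _ ⟨g, ⟨hg, h, hh, hhx⟩, rfl⟩
  refine ⟨(hχ.apply_mem_normalizer_iff Subgroup.le_normalizer hg).2 hg, h, by rwa [himg],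
    fun y hy => ?_⟩
  obtain ⟨x, hx, rfl⟩ := (hχ.restrict Subgroup.le_normalizer).mem_img.1 hy
  rw [← hχ.map_conj hg (Subgroup.le_normalizer hx), Function.comp_apply, Function.comp_apply,
    hl x hx, hl _ ((Subgroup.mem_normalizer_iff.1 hg x).1 hx), hhx x hx]

variable [Finite S] [Fact p.Prime]

namespace IsDetachable

theorem isConj (hA : F.IsDetachable (insert ⊤ (C \ {P})) P A) (hS : IsPGroup p S)
    (hF : F.IsSaturated p) (hC : F.IsEssentialReps p C) (ha : F.IsFullyAutomized p R)
    (hr : F.IsReceptive R) (hAR : F.IsConj A R) :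
    (F.generateAut (insert ⊤ (C \ {P}))).IsConj A R := by
  obtain ⟨χ, hχ, hχP, -⟩ := hA
  have hχA := (hχ.restrict Subgroup.le_normalizer).isConj
  obtain ⟨k, hk, rfl⟩ :=
    exists_isMor_normalizer hS ha hr ((hχA.mono (F.generateAut_le _)).symm.trans hAR)
  exact hχA.trans
    ((hk.generateAut_of_not_subConj hS hF hC hχP).restrict Subgroup.le_normalizer).isConj

theorem exists_extension (hA : F.IsDetachable (insert ⊤ (C \ {P})) P A) (hS : IsPGroup p S)
    (hF : F.IsSaturated p) (hC : F.IsEssentialReps p C)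
    (hf : (F.generateAut (insert ⊤ (C \ {P}))).IsMor f A) (hr : F.IsReceptive (img f A)) :
    ∃ N : Subgroup S, (N : Set S) = extSet f A ∧
      ∃ k, (F.generateAut (insert ⊤ (C \ {P}))).IsMor k N ∧ ∀ x ∈ A, k x = f x := by
  obtain ⟨χ, hχ, -, hχN⟩ := hA
  have hχA := hχ.restrict Subgroup.le_normalizer
  obtain ⟨l, hl, hlx, hlA⟩ := hχA.exists_inverse
  have hfl := hf.comp hl hlA.le
  have himg : img (f ∘ l) (img χ A) = img f A := by rw [hl.img_comp, hlA]
  obtain ⟨M, hM, m, hm, hmx⟩ :=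
    isReceptive_iff.1 hr _ _ (hfl.mono (F.generateAut_le _)) himg
  have hmG : (F.generateAut (insert ⊤ (C \ {P}))).IsMor m M := by
    by_cases hMP : F.SubConj M P
    · obtain rfl := hχN _ (hfl.mono (F.generateAut_le _)) M hM hMP
      exact hfl.congr fun x hx => (hmx x hx).symm
    · exact hm.generateAut_of_not_subConj hS hF hC hMP
  obtain ⟨N, hN⟩ := hf.exists_coe_eq_extSet
  have hNA : N ≤ Subgroup.normalizer (A : Set S) :=
    SetLike.coe_subset_coe.1 (hN.trans_subset (extSet_subset_normalizer f A))
  have hNM : img χ N ≤ M := img_le_iff.2 fun g hg => SetLike.mem_coe.1 <|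
    hM ▸ hχ.image_extSet_subset hlx himg (Set.mem_image_of_mem χ (hN ▸ hg))
  refine ⟨N, hN, m ∘ χ, hmG.comp (hχ.restrict hNA) hNM, fun x hx => ?_⟩
  rw [Function.comp_apply, hmx _ (apply_mem_img χ hx), Function.comp_apply, hlx x hx]

end IsDetachable

theorem isSaturatedAt_generateAut (hS : IsPGroup p S) (hF : F.IsSaturated p)
    (hC : F.IsEssentialReps p C) (hY : F.IsNormalizerStable (insert ⊤ (C \ {P})) Y)
    (ha : Q ∈ Y → (F.generateAut (insert ⊤ (C \ {P}))).IsFullyAutomized p Q)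
    (h : ∀ A, F.IsConj Q A → A ∉ Y → F.IsDetachable (insert ⊤ (C \ {P})) P A) :
    (F.generateAut (insert ⊤ (C \ {P}))).IsSaturatedAt p Q := by
  have hD : ⊤ ∈ insert ⊤ (C \ {P}) := Set.mem_insert _ _
  by_cases hQ : Q ∈ Y
  · exact ⟨Q, .refl _ Q, ha hQ, hY.isReceptive hD hQ⟩
  obtain ⟨R, hQR, hRa, hRr⟩ := hF Q
  have hQR' := (h Q (.refl F Q) hQ).isConj hS hF hC hRa hRr hQR
  refine ⟨R, hQR', hRa.mono hS (autF_mono (F.generateAut_le _) R), isReceptive_iff.2 ?_⟩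
  rintro A f hf rfl
  refine (h A ?_ fun hA => ?_).exists_extension hS hF hC hf hRr
  · exact hQR.trans (hf.isConj.mono (F.generateAut_le _)).symm
  · exact hQ (hY.mem_of_isConj hD (hf.isConj.trans hQR'.symm) hA)

end FusionSystem

section

variable {p : ℕ} [Fact p.Prime] {X : Type*} [Group X]

theorem centralizer_le_centralizer_sup_center (R : Subgroup X) :
    Subgroup.centralizer (R : Set X) ≤
      Subgroup.centralizer ((R ⊔ Subgroup.center X : Subgroup X) : Set X) := by
  rw [Subgroup.le_centralizer_iff]
  exact sup_le (Subgroup.le_centralizer_iff.1 le_rfl) (Subgroup.center_le_centralizer _)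

variable [Finite X]

theorem sq_le_card_sup (hX : IsPGroup p X) {A B : Subgroup X} (hA : Nat.card A = p)
    (hB : Nat.card B = p) (h : A ≠ B) : p ^ 2 ≤ Nat.card (A ⊔ B : Subgroup X) := by
  rw [sq]
  nth_rw 1 [← hA]
  exact card_mul_le_card_of_lt hX <| left_lt_sup.2 fun hBA =>
    h (Subgroup.eq_of_le_of_card_ge hBA (by rw [hA, hB])).symm

theorem card_center_eq_of_card_le [Nontrivial X] (hX : IsPGroup p X)
    (h : Nat.card (Subgroup.center X) ≤ p) : Nat.card (Subgroup.center X) = p :=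
  h.antisymm <| Nat.le_of_dvd Nat.card_pos <|
    dvd_card_of_ne_bot (hX.to_subgroup _) hX.bot_lt_center.ne'

theorem centralizer_eq_center_of_lt (hX : IsPGroup p X) (hZ : Nat.card (Subgroup.center X) = p)
    {W E : Subgroup X} (hW : Nat.card W = p ^ 2) (hWC : Subgroup.centralizer (W : Set X) ≤ W)
    (hWE : W < E) : Subgroup.centralizer (E : Set X) = Subgroup.center X := by
  have hCW : Subgroup.centralizer (E : Set X) ≤ W := (Subgroup.centralizer_le hWE.le).trans hWC
  by_contra hne
  have hlt : Subgroup.center X < Subgroup.centralizer (E : Set X) :=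
    (Subgroup.center_le_centralizer _).lt_of_ne' hne
  have hcard := card_mul_le_card_of_lt hX hlt
  rw [hZ, ← sq] at hcard
  have hEW := Subgroup.eq_of_le_of_card_ge hCW (hW.trans_le hcard)
  exact hWE.not_ge ((Subgroup.le_centralizer_iff.1 hEW.ge).trans hWC)

theorem eq_bot_of_card_dvd_prime (hX : Nat.card X ∣ p) {U : Subgroup (MulAut X)}
    (hU : IsPGroup p U) : U = ⊥ := by
  rcases (Nat.dvd_prime Fact.out).1 hX with hX | hX
  · have := (Nat.card_eq_one_iff_unique.1 hX).1
    exact (Subgroup.eq_bot_iff_forall U).2 fun a _ => MulEquiv.ext fun x => Subsingleton.elim _ _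
  · exact eq_bot_of_card_eq_prime hX hU

end

namespace FusionSystem

variable {S : Type*} [Group S] {F : FusionSystem S} {p : ℕ} {C D Y : Set (Subgroup S)}
  {f : S → S} {A E P Q R W : Subgroup S}

theorem card_normalizer (A : Subgroup S) : Nat.card (Subgroup.normalizer (A : Set S)) =
    Nat.card (Subgroup.centralizer (A : Set S)) * Nat.card (autS A) := by
  rw [← (Subgroup.normalizerMonoidHom A).ker.card_mul_index, Subgroup.index_ker,
    Subgroup.normalizerMonoidHom_ker,
    Nat.card_congr (Subgroup.subgroupOfEquivOfLe (Subgroup.centralizer_le_normalizer _)).toEquiv,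
    autS]

theorem IsMor.img_centralizer_eq [Finite S] (hf : F.IsMor f E) (hfE : img f E = E)
    (hE : Subgroup.centralizer (E : Set S) ≤ E) :
    img f (Subgroup.centralizer (E : Set S)) = Subgroup.centralizer (E : Set S) := by
  refine Subgroup.eq_of_le_of_card_ge (img_le_iff.2 fun x hx => ?_) (hf.restrict hE).card_img.ge
  have := hf.apply_mem_centralizer le_rfl (hE hx) hx
  rwa [hfE] at this

namespace IsEssential

theorem centralizer_le (hP : F.IsEssential p P) (h : F.IsConj A P) :
    Subgroup.centralizer (A : Set S) ≤ A :=
  isSCentric_iff.1 (hP.2.1 A h.symm)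

theorem center_le (hP : F.IsEssential p P) : Subgroup.center S ≤ P :=
  (Subgroup.center_le_centralizer _).trans (hP.centralizer_le (.refl F P))

theorem nontrivial (hP : F.IsEssential p P) : Nontrivial S :=
  Subgroup.nontrivial_iff.1 ⟨⟨P, ⊤, hP.1.ne⟩⟩

variable [Finite S]

theorem card_lt (hP : F.IsEssential p P) : Nat.card P < Nat.card S :=
  (card_lt_card_of_lt hP.1).trans_eq Subgroup.card_top

theorem lt_normalizer [Fact p.Prime] (hS : IsPGroup p S) (hP : F.IsEssential p P)
    (h : F.IsConj A P) : A < Subgroup.normalizer (A : Set S) := by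
  refine lt_normalizer_of_ne_top hS ?_
  rintro rfl
  exact hP.card_lt.ne (h.card_eq.trans Subgroup.card_top)

theorem not_subConj_normalizer_of_le_center (hP : F.IsEssential p P)
    (hR : R ≤ Subgroup.center S) : ¬ F.SubConj (Subgroup.normalizer (R : Set S)) P := by
  have htop : Subgroup.normalizer (R : Set S) = ⊤ := top_le_iff.1 <|
    (Subgroup.centralizer_eq_top_iff_subset.2 hR).ge.trans (Subgroup.centralizer_le_normalizer _)
  intro h
  rw [htop] at h
  exact (h.card_le.trans_lt hP.card_lt).ne Subgroup.card_top

end IsEssential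

namespace IsEssentialReps

theorem center_le (hC : F.IsEssentialReps p C) (hE : E ∈ insert ⊤ (C \ {P})) :
    Subgroup.center S ≤ E := by
  rcases hE with rfl | ⟨hEC, -⟩
  · exact le_top
  · exact (hC.1 E hEC).center_le

theorem not_isConj [Finite S] (hC : F.IsEssentialReps p C) (hPC : P ∈ C)
    (hE : E ∈ insert ⊤ (C \ {P})) : ¬ F.IsConj E P := by
  intro h
  rcases hE with rfl | ⟨hEC, hEP⟩
  · exact (hC.1 P hPC).card_lt.ne (h.card_eq.trans Subgroup.card_top)
  · exact hEP ((hC.2 E (hC.1 E hEC)).unique ⟨hEC, .refl F E⟩ ⟨hPC, h⟩)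

end IsEssentialReps

theorem isDetached_of_not_subConj (h : ¬ F.SubConj A P) : F.IsDetached P A :=
  ⟨fun hN => h (hN.mono_left Subgroup.le_normalizer), fun _ hf _ hN hNP =>
    absurd (hNP.mono_left (SetLike.coe_subset_coe.1 (hN ▸ hf.subset_extSet))) h⟩

variable [Finite S] [Fact p.Prime]

theorem isDetached_of_isConj (hS : IsPGroup p S) (hP : F.IsEssential p P) (h : F.IsConj A P) :
    F.IsDetached P A := by
  refine ⟨fun hN => ?_, fun f hf N hN hNP => ?_⟩
  · exact ((card_lt_card_of_lt (hP.lt_normalizer hS h)).trans_le hN.card_le).ne h.card_eq.symm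
  · have hAN : A ≤ N := SetLike.coe_subset_coe.1 (hN ▸ hf.subset_extSet)
    exact (Subgroup.eq_of_le_of_card_ge hAN (h.card_eq ▸ hNP.card_le)).symm

theorem isSaturatedAt_generateAut_of_not_subConj (hS : IsPGroup p S) (hF : F.IsSaturated p)
    (hC : F.IsEssentialReps p C) (hQ : ¬ F.SubConj Q P) :
    (F.generateAut (insert ⊤ (C \ {P}))).IsSaturatedAt p Q :=
  isSaturatedAt_generateAut hS hF hC (Y := ∅) (fun _ h => h.elim) (fun h => h.elim)
    fun _ hA _ => (isDetached_of_not_subConj fun h => hQ (.of_isConj hA h)).isDetachable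

theorem isSaturatedAt_generateAut_of_isConj (hS : IsPGroup p S) (hF : F.IsSaturated p)
    (hC : F.IsEssentialReps p C) (hP : F.IsEssential p P) (hQ : F.IsConj Q P) :
    (F.generateAut (insert ⊤ (C \ {P}))).IsSaturatedAt p Q :=
  isSaturatedAt_generateAut hS hF hC (Y := ∅) (fun _ h => h.elim) (fun h => h.elim)
    fun _ hA _ => (isDetached_of_isConj hS hP (hA.symm.trans hQ)).isDetachable

theorem isFullyAutomized_of_card_dvd_prime (hS : IsPGroup p S) (hR : Nat.card R ∣ p) :
    F.IsFullyAutomized p R :=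
  isFullyAutomized_of_card_le hS fun U hU => by
    rw [eq_bot_of_card_dvd_prime hR hU, eq_bot_of_card_dvd_prime hR (isPGroup_autS hS R)]

theorem normalizer_eq_centralizer_of_card_dvd_prime (hS : IsPGroup p S) (hR : Nat.card R ∣ p) :
    Subgroup.normalizer (R : Set S) = Subgroup.centralizer (R : Set S) := by
  refine (Subgroup.eq_of_le_of_card_ge (Subgroup.centralizer_le_normalizer _) ?_).symm
  rw [card_normalizer, eq_bot_of_card_dvd_prime hR (isPGroup_autS hS R), Subgroup.card_bot,
    mul_one]

theorem isDetached_of_card_dvd_prime (hS : IsPGroup p S) (hR : Nat.card R ∣ p)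
    (h : ¬ F.SubConj (Subgroup.normalizer (R : Set S)) P) : F.IsDetached P R := by
  refine ⟨h, fun f _ N hN hNP => absurd (hNP.mono_left ?_) h⟩
  rw [normalizer_eq_centralizer_of_card_dvd_prime hS hR, ← SetLike.coe_subset_coe, hN]
  exact centralizer_subset_extSet f R

theorem isNormalizerStable_sup_center (hS : IsPGroup p S)
    (hZ : Nat.card (Subgroup.center S) = p) (hZD : ∀ E ∈ D, Subgroup.center S ≤ E)
    (hY : ∀ W ∈ Y, Nat.card W = p ^ 2 ∧ Subgroup.centralizer (W : Set S) ≤ W)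
    (hYD : ∀ W ∈ Y, ∀ E ∈ D, W ≤ E →
      W ≠ E ∧ ∀ a, F.IsMor a E → img a E = E → img a W ∈ Y) :
    F.IsNormalizerStable D
      {R | Nat.card R = p ∧ R ≠ Subgroup.center S ∧ R ⊔ Subgroup.center S ∈ Y} := by
  rintro R ⟨hR, hRZ, hRY⟩ E hE hRE
  obtain ⟨hW, hWC⟩ := hY _ hRY
  have hZE := hZD E hE
  have hWE := sup_le hRE hZE
  obtain ⟨hWne, hEY⟩ := hYD _ hRY E hE hWE
  have hCE := centralizer_eq_center_of_lt hS hZ hW hWC (hWE.lt_of_ne hWne)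
  refine ⟨?_, fun a ha haE => ?_⟩
  · rw [normalizer_eq_centralizer_of_card_dvd_prime hS hR.dvd]
    exact (centralizer_le_centralizer_sup_center R).trans (hWC.trans hWE)
  · have haZ : img a (Subgroup.center S) = Subgroup.center S := by
      have := ha.img_centralizer_eq haE (hCE.trans_le hZE)
      rwa [hCE] at this
    refine ⟨(ha.restrict hRE).card_img.trans hR, fun h => hRZ ?_, ?_⟩
    · exact (ha.img_inj hRE hZE).1 (h.trans haZ.symm)
    · have := hEY a ha haE
      rwa [ha.img_sup hRE hZE, haZ] at this

theorem isSaturatedAt_generateAut_of_card_dvd_prime (hS : IsPGroup p S) (hF : F.IsSaturated p)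
    (hC : F.IsEssentialReps p C) (hP : F.IsEssential p P)
    (hZ : Nat.card (Subgroup.center S) = p)
    (hY : ∀ W ∈ Y, Nat.card W = p ^ 2 ∧ Subgroup.centralizer (W : Set S) ≤ W)
    (hYD : ∀ W ∈ Y, ∀ E ∈ insert ⊤ (C \ {P}), W ≤ E →
      W ≠ E ∧ ∀ a, F.IsMor a E → img a E = E → img a W ∈ Y)
    (h : ∀ R : Subgroup S, Nat.card R = p → R ≠ Subgroup.center S → R ⊔ Subgroup.center S ∉ Y →
      F.IsDetachable (insert ⊤ (C \ {P})) P R)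
    (hQ : Nat.card Q ∣ p) : (F.generateAut (insert ⊤ (C \ {P}))).IsSaturatedAt p Q := by
  refine isSaturatedAt_generateAut hS hF hC
    (isNormalizerStable_sup_center hS hZ (fun E => hC.center_le) hY hYD)
    (fun _ => isFullyAutomized_of_card_dvd_prime hS hQ) fun R hQR hRY => ?_
  have hR : Nat.card R ∣ p := hQR.card_eq ▸ hQ
  by_cases hRZ : R ≤ Subgroup.center S
  · exact (isDetached_of_card_dvd_prime hS hR
      (hP.not_subConj_normalizer_of_le_center hRZ)).isDetachable
  · have hRp : Nat.card R = p := by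
      refine ((Nat.dvd_prime Fact.out).1 hR).resolve_left fun h1 => hRZ ?_
      exact (Subgroup.card_eq_one.1 h1).trans_le bot_le
    have hne : R ≠ Subgroup.center S := fun h => hRZ h.le
    exact h R hRp hne fun hRY' => hRY ⟨hRp, hne, hRY'⟩

theorem SubConj.card_dvd {n : ℕ} (hS : IsPGroup p S) (h : F.SubConj Q P)
    (hP : Nat.card P = p ^ (n + 1)) (hQ : ¬ F.IsConj Q P) : Nat.card Q ∣ p ^ n := by
  obtain ⟨m, hm⟩ := (hS.to_subgroup Q).exists_card_eq
  have hlt : p ^ m < p ^ (n + 1) := by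
    rw [← hm, ← hP]
    exact lt_of_not_ge fun hc => hQ (h.isConj_of_card_le hc)
  rw [hm]
  have hp := (Fact.out : p.Prime).one_lt
  exact pow_dvd_pow p (Nat.le_of_lt_succ ((Nat.pow_lt_pow_iff_right hp).1 hlt))

theorem IsEssential.card_center_of_card_eq_sq (hS : IsPGroup p S) (hP : F.IsEssential p P)
    (hc : Nat.card P = p ^ 2) : Nat.card (Subgroup.center S) = p := by
  have := hP.nontrivial
  have hlt : Subgroup.center S < P := hP.center_le.lt_of_ne fun h => hP.1.not_ge <|
    (Subgroup.centralizer_eq_top_iff_subset.2 h.ge).ge.trans (hP.centralizer_le (.refl F P))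
  refine card_center_eq_of_card_le hS ?_
  have hcard := card_mul_le_card_of_lt hS hlt
  rw [hc, sq] at hcard
  exact Nat.le_of_mul_le_mul_right hcard (Fact.out : p.Prime).pos

theorem isSaturatedAt_generateAut_of_card_eq_sq (hS : IsPGroup p S) (hF : F.IsSaturated p)
    (hC : F.IsEssentialReps p C) (hPC : P ∈ C) (hP : Nat.card P = p ^ 2) (hQ : Nat.card Q ∣ p) :
    (F.generateAut (insert ⊤ (C \ {P}))).IsSaturatedAt p Q := by
  have hess := hC.1 P hPC
  have hZ := hess.card_center_of_card_eq_sq hS hP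
  refine isSaturatedAt_generateAut_of_card_dvd_prime hS hF hC hess hZ (Y := {W | F.IsConj W P})
    (fun W hW => ⟨hW.card_eq.symm.trans hP, hess.centralizer_le hW⟩)
    (fun W hW E hE hWE => ⟨?_, fun a ha _ => (ha.restrict hWE).isConj.symm.trans hW⟩)
    (fun R hR hRZ hRY => ?_) hQ
  · rintro rfl
    exact hC.not_isConj hPC hE hW
  · refine (isDetached_of_card_dvd_prime hS hR.dvd fun hN => hRY ?_).isDetachable
    have hW : F.SubConj (R ⊔ Subgroup.center S) P := hN.mono_left <| sup_le
      Subgroup.le_normalizer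
      ((Subgroup.center_le_centralizer _).trans (Subgroup.centralizer_le_normalizer _))
    exact hW.isConj_of_card_le (hP.trans_le (sq_le_card_sup hS hR hZ hRZ))

end FusionSystem

section

variable {p : ℕ} [Fact p.Prime] {X : Type*} [Group X] [Finite X]

theorem eq_of_lt_of_le_of_card_le (hX : IsPGroup p X) {W B A : Subgroup X} (hWB : W < B)
    (hBA : B ≤ A) (h : Nat.card A ≤ Nat.card W * p) : B = A :=
  Subgroup.eq_of_le_of_card_ge hBA (h.trans (card_mul_le_card_of_lt hX hWB))

theorem normalizer_le_of_lt (hX : IsPGroup p X) {A E : Subgroup X} (hAE : A < E)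
    (h : Nat.card (Subgroup.normalizer (A : Set X)) ≤ Nat.card A * p) :
    Subgroup.normalizer (A : Set X) ≤ E := by
  obtain ⟨x, hxE, hxA, hxN⟩ := exists_mem_normalizer_of_lt hX hAE
  have hlt : A < Subgroup.normalizer (A : Set X) ⊓ E := SetLike.lt_iff_le_and_exists.2
    ⟨le_inf Subgroup.le_normalizer hAE.le, x, Subgroup.mem_inf.2 ⟨hxN, hxE⟩, hxA⟩
  exact inf_eq_left.1 (eq_of_lt_of_le_of_card_le hX hlt inf_le_left h)

namespace IsNonabelianCube

theorem card_le_of_le_centralizer {A W : Subgroup X} (hA : IsNonabelianCube p A) (hWA : W ≤ A)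
    (h : A ≤ Subgroup.centralizer (W : Set X)) : Nat.card W ≤ p := by
  have hle : W.subgroupOf A ≤ Subgroup.center A := fun w hw => Subgroup.mem_center_iff.2 fun x =>
    Subtype.ext (Subgroup.mem_centralizer_iff.1 (h x.2) w hw).symm
  rw [← hA.card_center, ← Nat.card_congr (Subgroup.subgroupOfEquivOfLe hWA).toEquiv]
  exact Subgroup.card_le_of_le hle

theorem not_le_centralizer {A W : Subgroup X} (hA : IsNonabelianCube p A) (hWA : W ≤ A)
    (hW : Nat.card W = p ^ 2) : ¬ A ≤ Subgroup.centralizer (W : Set X) := fun h =>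
  (hA.card_le_of_le_centralizer hWA h).not_gt <|
    hW ▸ lt_self_pow₀ (Fact.out : p.Prime).one_lt one_lt_two

theorem centralizer_inf_le (hX : IsPGroup p X) {A W : Subgroup X} (hA : IsNonabelianCube p A)
    (hWA : W ≤ A) (hW : Nat.card W = p ^ 2) : Subgroup.centralizer (W : Set X) ⊓ A ≤ W := by
  have := IsPGroup.isMulCommutative_of_card_eq_prime_sq hW
  by_contra hc
  have hlt : W < Subgroup.centralizer (W : Set X) ⊓ A :=
    (le_inf W.le_centralizer hWA).lt_of_not_ge hc
  refine hA.not_le_centralizer hWA hW (inf_eq_right.1 ?_)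
  exact eq_of_lt_of_le_of_card_le hX hlt inf_le_right (by rw [hA.1, hW, pow_succ])

end IsNonabelianCube

open scoped Pointwise in
theorem normalizer_le_normalizer_map_subtype {X : Type*} [Group X] {P : Subgroup X}
    {V : Subgroup P} (h : ∀ u ∈ FusionSystem.autS P, u • V = V) :
    Subgroup.normalizer (P : Set X) ≤ Subgroup.normalizer (V.map P.subtype : Set X) := by
  intro n hn
  have hV := h (Subgroup.normalizerMonoidHom P ⟨n, hn⟩) ⟨_, rfl⟩
  rw [Subgroup.mem_normalizer_iff_map_conj_eq]
  conv_rhs => rw [← hV]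
  rw [Subgroup.map_map]
  exact (Subgroup.map_map V P.subtype
    (MulEquiv.toMonoidHom (Subgroup.normalizerMonoidHom P ⟨n, hn⟩))).symm

end

namespace FusionSystem

variable {S : Type*} [Group S] {F : FusionSystem S} {p : ℕ} {C : Set (Subgroup S)}
  {f : S → S} {A E N P Q R T W : Subgroup S}

theorem IsConj.isNonabelianCube (h : F.IsConj A P) (hP : IsNonabelianCube p P) :
    IsNonabelianCube p A := by
  obtain ⟨f, hf, rfl⟩ := isConj_iff.1 h
  obtain ⟨e, -⟩ := hf.exists_mulEquiv
  exact hP.of_mulEquiv e.symm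

open scoped Pointwise in
theorem isConj_map_subtype {b : MulAut P} (hb : b ∈ F.autF P) (V : Subgroup P) :
    F.IsConj (V.map P.subtype) ((b • V).map P.subtype) := by
  obtain ⟨k, hk⟩ := exists_forall_coe_eq b
  refine isConj_iff.2 ⟨k, ((mem_autF_iff hk).1 hb).restrict (Subgroup.map_subtype_le V), ?_⟩
  rw [img_eq_map (φ := b.toMonoidHom) hk (Subgroup.map_subtype_le V)]
  rw [Subgroup.subgroupOf, Subgroup.comap_map_eq_self_of_injective P.subtype_injective]
  exact (Subgroup.map_map V P.subtype b.toMonoidHom).symm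

theorem IsMor.img_normalizer_le (hf : F.IsMor f (Subgroup.normalizer (W : Set S))) :
    img f (Subgroup.normalizer (W : Set S)) ≤ Subgroup.normalizer (img f W : Set S) :=
  img_le_iff.2 fun _ hx => (hf.apply_mem_normalizer_iff Subgroup.le_normalizer hx).2 hx

theorem IsMor.normalizer_img_inf_img_le (hf : F.IsMor f E) (hW : W ≤ E) :
    Subgroup.normalizer (img f W : Set S) ⊓ img f E ≤ img f (Subgroup.normalizer (W : Set S)) := by
  intro y hy
  obtain ⟨hyW, hyE⟩ := Subgroup.mem_inf.1 hy
  obtain ⟨x, hx, rfl⟩ := hf.mem_img.1 hyE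
  exact apply_mem_img f ((hf.apply_mem_normalizer_iff hW hx).1 hyW)

/-- The subgroups of order `p²` whose normalizer in `S` is `F`-conjugate to `P`. If `P` is a
non-abelian pearl of order `p³`, these are the subgroups of order `p²` that stay
normalizer-stable once `P` is removed. -/
def normalizerConj (F : FusionSystem S) (p : ℕ) (P : Subgroup S) : Set (Subgroup S) :=
  {W | Nat.card W = p ^ 2 ∧ F.IsConj (Subgroup.normalizer (W : Set S)) P}

theorem card_normalizer_of_mem_normalizerConj (hP : IsNonabelianCube p P)
    (hW : W ∈ F.normalizerConj p P) :
    Nat.card (Subgroup.normalizer (W : Set S)) = Nat.card W * p := by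
  rw [hW.1, ← pow_succ, (hW.2.isNonabelianCube hP).1]

variable [Finite S] [Fact p.Prime]

theorem card_normalizer_le_of_card_eq_sq (hS : IsPGroup p S) (hW : Nat.card W = p ^ 2)
    (hWC : Subgroup.centralizer (W : Set S) ≤ W) :
    Nat.card (Subgroup.normalizer (W : Set S)) ≤ Nat.card W * p := by
  rw [card_normalizer]
  exact Nat.mul_le_mul (Subgroup.card_le_of_le hWC)
    (card_le_of_card_eq_sq hW (isPGroup_autS hS W))

theorem card_normalizer_le_of_isNonabelianCube (hS : IsPGroup p S) (hA : IsNonabelianCube p A)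
    (hAC : Subgroup.centralizer (A : Set S) ≤ A) :
    Nat.card (Subgroup.normalizer (A : Set S)) ≤ Nat.card A * p := by
  rw [card_normalizer, hA.1, mul_comm]
  exact Nat.mul_le_mul (hA.card_le_of_isPGroup (isPGroup_autS hS A))
    (hA.card_le_of_le_centralizer hAC (Subgroup.le_centralizer_iff.1 le_rfl))

theorem IsEssential.exists_isConj_pow_four_le_card_normalizer (hS : IsPGroup p S)
    (hP : F.IsEssential p P) (hP3 : IsNonabelianCube p P) (hW : Nat.card W = p ^ 2)
    (hWP : F.SubConj W P) :
    ∃ W', F.IsConj W W' ∧ p ^ 4 ≤ Nat.card (Subgroup.normalizer (W' : Set S)) := by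
  obtain ⟨B, hBP, hWB⟩ := hWP
  obtain ⟨H, hH⟩ := hP.2.2.2
  have hB : Nat.card (B.subgroupOf P) = p ^ 2 :=
    (Nat.card_congr (Subgroup.subgroupOfEquivOfLe hBP).toEquiv).trans (hWB.card_eq.trans hW)
  obtain ⟨b, hb, hbU⟩ := hP3.exists_forall_smul_smul_eq
    ((innAut_le_autS P).trans (F.autS_le_autF P)) hH (isPGroup_autS hS P) (F.autS_le_autF P) hB
  have hconj := isConj_map_subtype hb (B.subgroupOf P)
  rw [Subgroup.map_subgroupOf_eq_of_le hBP] at hconj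
  refine ⟨_, hWB.trans hconj, ?_⟩
  calc p ^ 4 = Nat.card P * p := by rw [hP3.1, ← pow_succ]
    _ ≤ Nat.card (Subgroup.normalizer (P : Set S)) :=
      card_mul_le_card_of_lt hS (hP.lt_normalizer hS (.refl F P))
    _ ≤ _ := Subgroup.card_le_of_le (normalizer_le_normalizer_map_subtype hbU)

theorem SubConj.isConj_of_lt (hS : IsPGroup p S) (hP : Nat.card P = p ^ 3)
    (hW : Nat.card W = p ^ 2) (hWN : W < N) (hN : F.SubConj N P) : F.IsConj N P := by
  refine hN.isConj_of_card_le ?_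
  rw [hP, pow_succ, ← hW]
  exact card_mul_le_card_of_lt hS hWN

theorem centralizer_le_of_mem_normalizerConj (hS : IsPGroup p S) (hP : IsNonabelianCube p P)
    (hW : W ∈ F.normalizerConj p P) : Subgroup.centralizer (W : Set S) ≤ W := by
  rw [← inf_eq_left.2 (Subgroup.centralizer_le_normalizer (W : Set S))]
  exact (hW.2.isNonabelianCube hP).centralizer_inf_le hS Subgroup.le_normalizer hW.1

namespace IsEssentialReps

theorem ne_of_mem_normalizerConj (hS : IsPGroup p S) (hC : F.IsEssentialReps p C) (hPC : P ∈ C)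
    (hP : IsNonabelianCube p P) (hW : W ∈ F.normalizerConj p P)
    (hE : E ∈ insert ⊤ (C \ {P})) : W ≠ E := by
  rintro rfl
  rcases hE with rfl | ⟨hWC, -⟩
  · have htop := hW.2
    rw [Subgroup.normalizer_eq_top] at htop
    exact hC.not_isConj hPC (Set.mem_insert _ _) htop
  · obtain ⟨W', hWW', hcard⟩ := (hC.1 P hPC).exists_isConj_pow_four_le_card_normalizer hS hP hW.1
      (SubConj.mono_left ⟨P, le_rfl, hW.2⟩ Subgroup.le_normalizer)
    have hle := hcard.trans ((hC.1 W hWC).2.2.1 W' hWW')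
    rw [(hW.2.isNonabelianCube hP).1, Nat.pow_le_pow_iff_right (Fact.out : p.Prime).one_lt] at hle
    omega

theorem normalizer_le_of_mem_normalizerConj (hS : IsPGroup p S) (hC : F.IsEssentialReps p C)
    (hPC : P ∈ C) (hP : IsNonabelianCube p P) (hW : W ∈ F.normalizerConj p P)
    (hE : E ∈ insert ⊤ (C \ {P})) (hWE : W ≤ E) : Subgroup.normalizer (W : Set S) ≤ E :=
  normalizer_le_of_lt hS (hWE.lt_of_ne (hC.ne_of_mem_normalizerConj hS hPC hP hW hE))
    (card_normalizer_of_mem_normalizerConj hP hW).le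

theorem normalizer_img_eq (hS : IsPGroup p S) (hC : F.IsEssentialReps p C) (hPC : P ∈ C)
    (hP : IsNonabelianCube p P) (hW : W ∈ F.normalizerConj p P)
    (hE : E ∈ insert ⊤ (C \ {P})) (hWE : W ≤ E) (hf : F.IsMor f E) (hfE : img f E = E) :
    Subgroup.normalizer (img f W : Set S) = img f (Subgroup.normalizer (W : Set S)) := by
  have hNE := hC.normalizer_le_of_mem_normalizerConj hS hPC hP hW hE hWE
  have hM : F.IsConj (img f (Subgroup.normalizer (W : Set S))) P :=
    (hf.restrict hNE).isConj.symm.trans hW.2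
  have hME : img f (Subgroup.normalizer (W : Set S)) < E :=
    ((img_mono f hNE).trans hfE.le).lt_of_ne fun h => hC.not_isConj hPC hE (h ▸ hM)
  have hcard := card_normalizer_le_of_isNonabelianCube hS (hM.isNonabelianCube hP)
    ((hC.1 P hPC).centralizer_le hM)
  -- Otherwise `f(N_S(W))` would be self-normalizing.
  by_contra hne
  have hMN := (hf.restrict hNE).img_normalizer_le.lt_of_ne' hne
  have hle := hf.normalizer_img_inf_img_le hWE
  rw [hfE] at hle
  exact ((hC.1 P hPC).lt_normalizer hS hM).not_ge <|
    (le_inf (normalizer_le_of_lt hS hMN hcard) (normalizer_le_of_lt hS hME hcard)).trans hle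

theorem img_mem_normalizerConj (hS : IsPGroup p S) (hC : F.IsEssentialReps p C) (hPC : P ∈ C)
    (hP : IsNonabelianCube p P) (hW : W ∈ F.normalizerConj p P)
    (hE : E ∈ insert ⊤ (C \ {P})) (hWE : W ≤ E) (hf : F.IsMor f E) (hfE : img f E = E) :
    img f W ∈ F.normalizerConj p P := by
  have hNE := hC.normalizer_le_of_mem_normalizerConj hS hPC hP hW hE hWE
  refine ⟨(hf.restrict hWE).card_img.trans hW.1, ?_⟩
  rw [hC.normalizer_img_eq hS hPC hP hW hE hWE hf hfE]
  exact (hf.restrict hNE).isConj.symm.trans hW.2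

end IsEssentialReps

theorem isNormalizerStable_normalizerConj (hS : IsPGroup p S) (hC : F.IsEssentialReps p C)
    (hPC : P ∈ C) (hP : IsNonabelianCube p P) :
    F.IsNormalizerStable (insert ⊤ (C \ {P})) (F.normalizerConj p P) := fun _ hW _ hE hWE =>
  ⟨hC.normalizer_le_of_mem_normalizerConj hS hPC hP hW hE hWE,
    fun _ => hC.img_mem_normalizerConj hS hPC hP hW hE hWE⟩

theorem isFullyAutomized_of_mem_normalizerConj {G : FusionSystem S} (hS : IsPGroup p S)
    (hP : IsNonabelianCube p P) (hW : W ∈ F.normalizerConj p P) : G.IsFullyAutomized p W := by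
  refine isFullyAutomized_of_card_le hS fun U hU => (card_le_of_card_eq_sq hW.1 hU).trans ?_
  refine Nat.le_of_mul_le_mul_left ?_ (Nat.card_pos (α := W))
  rw [← card_normalizer_of_mem_normalizerConj hP hW, card_normalizer]
  exact Nat.mul_le_mul_right _
    (Subgroup.card_le_of_le (centralizer_le_of_mem_normalizerConj hS hP hW))

theorem IsEssential.ne_top_of_card_eq_sq (hP : F.IsEssential p P) (hP3 : Nat.card P = p ^ 3)
    (hW : Nat.card W = p ^ 2) : W ≠ ⊤ := by
  rintro rfl
  have hlt := hP.card_lt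
  rw [← Subgroup.card_top (G := S), hW, hP3] at hlt
  exact absurd ((Nat.pow_lt_pow_iff_right (Fact.out : p.Prime).one_lt).1 hlt) (by norm_num)

theorem IsEssential.mem_normalizerConj_of_subConj (hS : IsPGroup p S) (hP : F.IsEssential p P)
    (hP3 : Nat.card P = p ^ 3) (hW : Nat.card W = p ^ 2)
    (h : F.SubConj (Subgroup.normalizer (W : Set S)) P) : W ∈ F.normalizerConj p P :=
  ⟨hW, h.isConj_of_lt hS hP3 hW (lt_normalizer_of_ne_top hS (hP.ne_top_of_card_eq_sq hP3 hW))⟩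

theorem IsEssential.isDetached_of_card_eq_sq (hS : IsPGroup p S) (hP : F.IsEssential p P)
    (hP3 : IsNonabelianCube p P) (hW : Nat.card W = p ^ 2) (hWY : W ∉ F.normalizerConj p P) :
    F.IsDetached P W := by
  refine ⟨fun h => hWY (hP.mem_normalizerConj_of_subConj hS hP3.1 hW h), fun f hf N hN hNP => ?_⟩
  by_contra hne
  have hWN : W ≤ N := SetLike.coe_subset_coe.1 (hN ▸ hf.subset_extSet)
  have hlt := hWN.lt_of_ne' hne
  have hconj := hNP.isConj_of_lt hS hP3.1 hW hlt
  have hCN : Subgroup.centralizer (W : Set S) ≤ N :=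
    SetLike.coe_subset_coe.1 (hN ▸ centralizer_subset_extSet f W)
  have hCW := inf_eq_left.2 hCN ▸ (hconj.isNonabelianCube hP3).centralizer_inf_le hS hWN hW
  have hNN : N ≤ Subgroup.normalizer (W : Set S) :=
    SetLike.coe_subset_coe.1 (hN ▸ extSet_subset_normalizer f W)
  have hN' := eq_of_lt_of_le_of_card_le hS hlt hNN (card_normalizer_le_of_card_eq_sq hS hW hCW)
  exact hWY ⟨hW, hN' ▸ hconj⟩

theorem isSaturatedAt_generateAut_of_isNonabelianCube_of_card_eq_sq (hS : IsPGroup p S)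
    (hF : F.IsSaturated p) (hC : F.IsEssentialReps p C) (hPC : P ∈ C)
    (hP : IsNonabelianCube p P) (hQ : Nat.card Q = p ^ 2) :
    (F.generateAut (insert ⊤ (C \ {P}))).IsSaturatedAt p Q :=
  isSaturatedAt_generateAut hS hF hC (isNormalizerStable_normalizerConj hS hC hPC hP)
    (isFullyAutomized_of_mem_normalizerConj hS hP) fun _ hQA hA =>
      ((hC.1 P hPC).isDetached_of_card_eq_sq hS hP (hQA.card_eq.trans hQ) hA).isDetachable

theorem IsEssential.card_center_of_isNonabelianCube (hS : IsPGroup p S) (hP : F.IsEssential p P)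
    (hP3 : IsNonabelianCube p P) : Nat.card (Subgroup.center S) = p := by
  have := hP.nontrivial
  exact card_center_eq_of_card_le hS <| hP3.card_le_of_le_centralizer hP.center_le <|
    Subgroup.le_centralizer_iff.1 (Subgroup.center_le_centralizer _)

theorem not_subConj_of_le_centralizer (hS : IsPGroup p S) (hP : IsNonabelianCube p P)
    (hW : Nat.card W = p ^ 2) (hWR : W < R) (hR : R ≤ Subgroup.centralizer (W : Set S)) :
    ¬ F.SubConj R P := fun h =>
  ((h.isConj_of_lt hS hP.1 hW hWR).isNonabelianCube hP).not_le_centralizer hWR.le hW hR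

theorem card_eq_sq_of_le_centralizer (hS : IsPGroup p S) (hP : IsNonabelianCube p P)
    (hW : p ^ 2 ≤ Nat.card W) (h : F.SubConj W P) (hWC : W ≤ Subgroup.centralizer (W : Set S)) :
    Nat.card W = p ^ 2 := by
  by_cases hWP : F.IsConj W P
  · have := (hWP.isNonabelianCube hP).card_le_of_le_centralizer le_rfl hWC
    exact absurd (hW.trans this) (lt_self_pow₀ (Fact.out : p.Prime).one_lt one_lt_two).not_ge
  · exact (Nat.le_of_dvd (Nat.pos_of_neZero _) (h.card_dvd hS hP.1 hWP)).antisymm hW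

theorem card_sup_center_and_normalizer_eq (hS : IsPGroup p S) (hP : IsNonabelianCube p P)
    (hZ : Nat.card (Subgroup.center S) = p) (hR : Nat.card R = p) (hRZ : R ≠ Subgroup.center S)
    (h : F.SubConj (Subgroup.normalizer (R : Set S)) P) :
    Nat.card (R ⊔ Subgroup.center S : Subgroup S) = p ^ 2 ∧
      Subgroup.normalizer (R : Set S) = R ⊔ Subgroup.center S := by
  rw [normalizer_eq_centralizer_of_card_dvd_prime hS hR.dvd] at h ⊢
  have := isCyclic_of_prime_card hR
  have hle : R ⊔ Subgroup.center S ≤ Subgroup.centralizer (R : Set S) :=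
    sup_le R.le_centralizer (Subgroup.center_le_centralizer _)
  have hC := centralizer_le_centralizer_sup_center R
  have hW := card_eq_sq_of_le_centralizer hS hP (sq_le_card_sup hS hR hZ hRZ)
    (h.mono_left hle) (hle.trans hC)
  exact ⟨hW, by_contra fun hne =>
    not_subConj_of_le_centralizer hS hP hW (hle.lt_of_ne' hne) hC h⟩

theorem IsEssential.pow_three_le_card_centralizer (hS : IsPGroup p S) (hP : F.IsEssential p P)
    (hP3 : IsNonabelianCube p P) (hT : Nat.card T = p ^ 2) (hTn : F.IsFullyNormalized T)
    (hTP : F.SubConj T P) : p ^ 3 ≤ Nat.card (Subgroup.centralizer (T : Set S)) := by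
  obtain ⟨T', hTT', hT'⟩ := hP.exists_isConj_pow_four_le_card_normalizer hS hP3 hT hTP
  refine Nat.le_of_mul_le_mul_right (?_ : _ * p ≤ _ * p) (Fact.out : p.Prime).pos
  calc p ^ 3 * p = p ^ 4 := (pow_succ p 3).symm
    _ ≤ Nat.card (Subgroup.normalizer (T : Set S)) := hT'.trans (hTn T' hTT')
    _ = Nat.card (Subgroup.centralizer (T : Set S)) * Nat.card (autS T) := card_normalizer T
    _ ≤ _ := Nat.mul_le_mul_left _ (card_le_of_card_eq_sq hT (isPGroup_autS hS T))

theorem IsEssential.isDetached_of_le_isFullyNormalized (hS : IsPGroup p S)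
    (hP : F.IsEssential p P) (hP3 : IsNonabelianCube p P) (hT : Nat.card T = p ^ 2)
    (hTn : F.IsFullyNormalized T) (hTP : F.SubConj T P) (hR : Nat.card R = p) (hRT : R ≤ T) :
    F.IsDetached P R := by
  refine isDetached_of_card_dvd_prime hS hR.dvd fun h => ?_
  rw [normalizer_eq_centralizer_of_card_dvd_prime hS hR.dvd] at h
  have := IsPGroup.isMulCommutative_of_card_eq_prime_sq hT
  have hlt : T < Subgroup.centralizer (T : Set S) := T.le_centralizer.lt_of_ne fun heq => by
    have hcard := hP.pow_three_le_card_centralizer hS hP3 hT hTn hTP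
    rw [← heq, hT, Nat.pow_le_pow_iff_right (Fact.out : p.Prime).one_lt] at hcard
    omega
  exact not_subConj_of_le_centralizer hS hP3 hT hlt le_rfl
    (h.mono_left (Subgroup.centralizer_le hRT))

theorem IsEssentialReps.isDetachable_of_card_eq_prime (hS : IsPGroup p S) (hF : F.IsSaturated p)
    (hC : F.IsEssentialReps p C) (hPC : P ∈ C) (hP : IsNonabelianCube p P)
    (hR : Nat.card R = p) (hRZ : R ≠ Subgroup.center S)
    (hRY : R ⊔ Subgroup.center S ∉ F.normalizerConj p P) :
    F.IsDetachable (insert ⊤ (C \ {P})) P R := by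
  have hess := hC.1 P hPC
  by_cases hRP : F.SubConj (Subgroup.normalizer (R : Set S)) P
  swap
  · exact (isDetached_of_card_dvd_prime hS hR.dvd hRP).isDetachable
  obtain ⟨hW, hN⟩ := card_sup_center_and_normalizer_eq hS hP
    (hess.card_center_of_isNonabelianCube hS hP) hR hRZ hRP
  rw [IsDetachable, hN]
  rw [hN] at hRP
  obtain ⟨T, hWT, hTa, hTr⟩ := hF (R ⊔ Subgroup.center S)
  obtain ⟨k, hk, hkT⟩ := exists_isMor_normalizer hS hTa hTr hWT
  have hkG := hk.generateAut_of_not_subConj hS hF hC fun h =>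
    hRY (hess.mem_normalizerConj_of_subConj hS hP.1 hW h)
  refine ⟨k, hkG.restrict Subgroup.le_normalizer, ?_⟩
  exact hess.isDetached_of_le_isFullyNormalized hS hP (hWT.card_eq.trans hW)
    (isFullyNormalized_of_isReceptive hS hTa hTr) (.of_isConj hWT.symm hRP)
    ((hk.restrict (le_sup_left.trans Subgroup.le_normalizer)).card_img.trans hR)
    (hkT ▸ img_mono k le_sup_left)

theorem isSaturatedAt_generateAut_of_isNonabelianCube (hS : IsPGroup p S)
    (hF : F.IsSaturated p) (hC : F.IsEssentialReps p C) (hPC : P ∈ C)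
    (hP : IsNonabelianCube p P) (hQ : Nat.card Q ∣ p ^ 2) :
    (F.generateAut (insert ⊤ (C \ {P}))).IsSaturatedAt p Q := by
  obtain ⟨k, hk, hQk⟩ := (Nat.dvd_prime_pow Fact.out).1 hQ
  rcases hk.eq_or_lt with rfl | hk
  · exact isSaturatedAt_generateAut_of_isNonabelianCube_of_card_eq_sq hS hF hC hPC hP hQk
  have hess := hC.1 P hPC
  refine isSaturatedAt_generateAut_of_card_dvd_prime hS hF hC hess
    (hess.card_center_of_isNonabelianCube hS hP) (Y := F.normalizerConj p P)
    (fun W hW => ⟨hW.1, centralizer_le_of_mem_normalizerConj hS hP hW⟩)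
    (fun W hW E hE hWE => ⟨hC.ne_of_mem_normalizerConj hS hPC hP hW hE,
      fun _ => hC.img_mem_normalizerConj hS hPC hP hW hE hWE⟩)
    (fun R => hC.isDetachable_of_card_eq_prime hS hF hPC hP)
    (hQk.dvd.trans <| (pow_dvd_pow p (Nat.le_of_lt_succ hk)).trans (pow_one p).dvd)

end FusionSystem

theorem lemma5 {S : Type*} [Group S] [Finite S] (p : ℕ) [Fact p.Prime] (hS : IsPGroup p S)
    (F : FusionSystem S) (hF : F.IsSaturated p)
    (C : Set (Subgroup S)) (hC : F.IsEssentialReps p C)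
    (P : Subgroup S) (hPC : P ∈ C) (hP : F.IsPearl p P) :
    (FusionSystem.generate (F.automizers (insert ⊤ (C \ {P})))).IsSaturated p := by
  intro Q
  by_cases hQP : F.SubConj Q P
  swap
  · exact FusionSystem.isSaturatedAt_generateAut_of_not_subConj hS hF hC hQP
  by_cases hQ : F.IsConj Q P
  · exact FusionSystem.isSaturatedAt_generateAut_of_isConj hS hF hC (hC.1 P hPC) hQ
  rcases hP.2 with hP2 | hP3
  · exact FusionSystem.isSaturatedAt_generateAut_of_card_eq_sq hS hF hC hPC hP2
      ((hQP.card_dvd hS hP2 hQ).trans (pow_one p).dvd)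
  · exact FusionSystem.isSaturatedAt_generateAut_of_isNonabelianCube hS hF hC hPC hP3
      (hQP.card_dvd hS hP3.1 hQ)
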